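/- Let $G$ be a connected graph on $K\ge 1$ nodes $1,\dots,K$. Node $k$ has a coefficient vector $\beta_k\in\mathbb R^d$, and the clusters are the maximal sets of nodes with equal coefficient vectors. Assume that every node belonging to a cluster with more than two members is adjacent in $G$ to another node of its cluster. At node $k$ one observes $y_{k,i}=\beta_k^\top x_{k,i}+\varepsilon_{k,i}$, $i=1,\dots,n$; put $N=Kn$. The covariates $x_{k,i}\in\mathbb R^d$ may be random, and the errors $\varepsilon_{k,i}$ are i.i.d. with mean $0$ and variance $\sigma^2<\infty$ and are independent of the covariates. Let $\hat b_k=(X_k^\top X_k)^{-1}X_k^\top y_k$ be the local least squares estimators. Let $T_n$ be a minimum spanning tree for the edge weights $\|\hat b_i-\hat b_j\|$ if $ij$ is an edge of $G$, and $\infty$ otherwise (any measurable choice among ties). Enumerate the edges of $T_n$ measurably as $l=1,\dots,K-1$, with endpoints $s(l)<e(l)$. Let $\tilde H_n$ be the $K\times K$ matrix whose $l$-th row, $l<K$, has entry $1$ at $s(l)$, $-1$ at $e(l)$ and $0$ elsewhere, and whose last row is $K^{-1/2}\mathbf 1^\top$. Put $\underline{\tilde H}_n=\tilde H_n\otimes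 I_d$, $X=\mathrm{diag}(X_1,\dots,X_K)$, and $\Delta_{*,n}=\underline{\tilde H}_n\beta$ with $\beta=(\beta_1^\top,\dots,\beta_K^\top)^\top$. Assume that $\frac1N(X\underline{\tilde H}_n^{-1})^\top X\underline{\tilde H}_n^{-1}\to C$ in probability for a positive definite matrix $C$. Let $\gamma>0$ and let $\lambda_N\ge0$ satisfy $\lambda_N/\sqrt N\to0$ and $\lambda_N N^{(\gamma-1)/2}\to\infty$. Let $\hat\Delta_n$ be a (measurable) minimizer over $\Delta\in\mathbb R^{dK}$ of $$\tfrac12\|y-X\underline{\tilde H}_n^{-1}\Delta\|^2+\lambda_N\sum_{q}\hat\pi_q|\Delta_q| ,\qquad \hat\pi_q=1/\big|[\underline{\tilde H}_n\hat b]_q\big|^{\gamma},$$ where an infinite weight forces $\Delta_q=0$, and where the last block of $d$ coordinates (the scaled network averages) is either penalized with the same adaptive weights or not penalized at all ($\hat\pi_q=0$); the theorem holds for both versions. Let $\hat A_n$ and $A_{*,n}$ be the sets of indices of the non-zero coordinates of $\hat\Delta_n$ and $\Delta_{*,n}$. Let $U=\emptyset$ if the averages are penalized, and otherwise let $U$ be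 the set of coordinates of the last block at which $\underline{\tilde H}_n\beta$ vanishes ($U$ does not depend on $T_n$). Then: (i) (Selection consistency) $\mathbb P(\hat A_n\cup U=A_{*,n}\cup U)\to1$ as $n\to\infty$. (ii) (Asymptotic normality) Suppose that the inter-cluster edges of $T_n$ and their positions in the enumeration are asymptotically non-random, that is, there is a fixed spanning tree $T_0$ with enumerated edges such that, with probability tending to one, for every $l$ the $l$-th edges of $T_n$ and $T_0$ are equal or both join nodes of the same cluster. Let $\Delta_*=(\tilde H_{T_0}\otimes I_d)\beta$ and $A=\{q:[\Delta_*]_q\neq0\}\cup U$ (so that $A=A_{*,n}\cup U$ with probability tending to one). Then $$\sqrt N\big([\hat\Delta_n]_{A}-[\Delta_*]_{A}\big)\xrightarrow{d}\mathcal N\big(0,\sigma^2 (C_{A})^{-1}\big),$$ where $C_A$ is the submatrix of $C$ with rows and columns in $A$. -/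

import Mathlib

open MeasureTheory ProbabilityTheory Filter Topology
open scoped ENNReal Kronecker

noncomputable section

namespace FusedLasso

variable {m d : ℕ}

/-! The network has `K = m + 1 ≥ 1` nodes, indexed by `Fin (m + 1)`. A function
`x : Fin (m + 1) → ℕ → Fin d → ℝ` gives the covariate vector `x k i` of the `i`-th observation at
node `k`, and `y : Fin (m + 1) → ℕ → ℝ` the responses; the data sets of size `n` consist of the
observations `i < n`. Vectors of `ℝ^{dK}` are indexed by `Fin (m + 1) × Fin d`. -/

/-- The total sample size `N = K n`. -/
def totalSize (m n : ℕ) : ℝ := ((m + 1) * n : ℕ)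

/-- The design matrix `X_k` of node `k`: its rows are the first `n` covariate vectors. -/
def nodeDesign (x : Fin (m + 1) → ℕ → Fin d → ℝ) (n : ℕ) (k : Fin (m + 1)) :
    Matrix (Fin n) (Fin d) ℝ :=
  Matrix.of fun i p => x k i p

/-- The local least squares estimator `(X_kᵀ X_k)⁻¹ X_kᵀ y_k`. -/
def ols (x : Fin (m + 1) → ℕ → Fin d → ℝ) (y : Fin (m + 1) → ℕ → ℝ) (n : ℕ) (k : Fin (m + 1)) :
    Fin d → ℝ :=
  Matrix.mulVec ((nodeDesign x n k).transpose * nodeDesign x n k)⁻¹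
    (Matrix.mulVec (nodeDesign x n k).transpose fun i => y k i)

/-- The similarity weight of a pair of nodes: the Euclidean distance of the two local least squares
estimators if the nodes are adjacent in the network, and `∞` otherwise. -/
def similarity (G : SimpleGraph (Fin (m + 1))) (x : Fin (m + 1) → ℕ → Fin d → ℝ)
    (y : Fin (m + 1) → ℕ → ℝ) (n : ℕ) (e : Fin (m + 1) × Fin (m + 1)) : ℝ≥0∞ :=
  open Classical in
  if G.Adj e.1 e.2 then
    ENNReal.ofReal ‖WithLp.toLp 2 (ols x y n e.1) - WithLp.toLp 2 (ols x y n e.2)‖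
  else ⊤

/-- `t` enumerates the `m = K - 1` edges of a spanning tree on the nodes; the `l`-th edge has starting
node `(t l).1`, ending node `(t l).2`, and starting node smaller than ending node. -/
structure IsSpanningTree (t : Fin m → Fin (m + 1) × Fin (m + 1)) : Prop where
  lt : ∀ l, (t l).1 < (t l).2
  injective : Function.Injective t
  isTree : (SimpleGraph.fromEdgeSet (Set.range fun l => s((t l).1, (t l).2))).IsTree

/-- `t` enumerates the edges of a spanning tree of minimal total weight. -/
def IsMinSpanningTree (w : Fin (m + 1) × Fin (m + 1) → ℝ≥0∞)
    (t : Fin m → Fin (m + 1) × Fin (m + 1)) : Prop :=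
  IsSpanningTree t ∧ ∀ t', IsSpanningTree t' → ∑ l, w (t l) ≤ ∑ l, w (t' l)

/-- The square matrix `H̃`: the incidence matrix of the tree, completed by the last row
`(1/√K, …, 1/√K)`. -/
def augIncidence (t : Fin m → Fin (m + 1) × Fin (m + 1)) :
    Matrix (Fin (m + 1)) (Fin (m + 1)) ℝ :=
  Matrix.of fun l i =>
    Fin.lastCases (motive := fun _ => ℝ) (1 / √((m : ℝ) + 1))
      (fun l => if i = (t l).1 then 1 else if i = (t l).2 then -1 else 0) l

/-- The matrix `H̃ ⊗ I_d`. -/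
def diffMatrix (d : ℕ) (t : Fin m → Fin (m + 1) × Fin (m + 1)) :
    Matrix (Fin (m + 1) × Fin d) (Fin (m + 1) × Fin d) ℝ :=
  augIncidence t ⊗ₖ (1 : Matrix (Fin d) (Fin d) ℝ)

/-- The vector `(H̃ ⊗ I_d) b`, where `b` stacks the coefficient vectors `b k` of the nodes. -/
def differences (t : Fin m → Fin (m + 1) × Fin (m + 1)) (b : Fin (m + 1) → Fin d → ℝ) :
    Fin (m + 1) × Fin d → ℝ :=
  Matrix.mulVec (diffMatrix d t) fun q => b q.1 q.2

/-- The block diagonal design matrix `X = diag(X_1, …, X_K)`. -/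
def blockDesign (x : Fin (m + 1) → ℕ → Fin d → ℝ) (n : ℕ) :
    Matrix (Fin (m + 1) × Fin n) (Fin (m + 1) × Fin d) ℝ :=
  Matrix.of fun r q => if r.1 = q.1 then nodeDesign x n r.1 r.2 q.2 else 0

/-- The transformed design matrix `X (H̃ ⊗ I_d)⁻¹`. -/
def transDesign (x : Fin (m + 1) → ℕ → Fin d → ℝ) (n : ℕ)
    (t : Fin m → Fin (m + 1) × Fin (m + 1)) :
    Matrix (Fin (m + 1) × Fin n) (Fin (m + 1) × Fin d) ℝ :=
  blockDesign x n * (diffMatrix d t)⁻¹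

/-- The normalized Gram matrix of the transformed design. -/
def gram (x : Fin (m + 1) → ℕ → Fin d → ℝ) (n : ℕ) (t : Fin m → Fin (m + 1) × Fin (m + 1)) :
    Matrix (Fin (m + 1) × Fin d) (Fin (m + 1) × Fin d) ℝ :=
  (1 / totalSize m n) • ((transDesign x n t).transpose * transDesign x n t)

/-- The coordinate `q` belongs to the last block (the scaled network averages) and that block is not
penalized. The Boolean `pen` tells whether the last block carries adaptive weights as well. -/
def IsFree (pen : Bool) (q : Fin (m + 1) × Fin d) : Prop :=
  pen = false ∧ q.1 = Fin.last m

/-- The adaptive weights `1 / |[(H̃ ⊗ I_d) b_OLS]_q|^γ`, equal to `∞` if the difference vanishes, and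
`0` on unpenalized coordinates. -/
def adaptiveWeight (pen : Bool) (γ : ℝ) (x : Fin (m + 1) → ℕ → Fin d → ℝ)
    (y : Fin (m + 1) → ℕ → ℝ) (n : ℕ) (t : Fin m → Fin (m + 1) × Fin (m + 1))
    (q : Fin (m + 1) × Fin d) : ℝ≥0∞ :=
  open Classical in
  if IsFree pen q then 0
  else (ENNReal.ofReal (|differences t (ols x y n) q| ^ γ))⁻¹

/-- The adaptive fused-lasso objective
`½ ‖y - X (H̃ ⊗ I_d)⁻¹ Δ‖² + lam * ∑_q weight_q |Δ_q|`. An infinite weight forces `Δ_q = 0`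
(`∞ * 0 = 0`). -/
def objective (pen : Bool) (γ lam : ℝ) (x : Fin (m + 1) → ℕ → Fin d → ℝ)
    (y : Fin (m + 1) → ℕ → ℝ) (n : ℕ) (t : Fin m → Fin (m + 1) × Fin (m + 1))
    (Δ : Fin (m + 1) × Fin d → ℝ) : ℝ≥0∞ :=
  ENNReal.ofReal
      (1 / 2 * ∑ r : Fin (m + 1) × Fin n, (y r.1 r.2 - (transDesign x n t).mulVec Δ r) ^ 2) +
    ENNReal.ofReal lam * ∑ q, adaptiveWeight pen γ x y n t q * ENNReal.ofReal |Δ q|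

/-- The set of non-zero coordinates. -/
def support (Δ : Fin (m + 1) × Fin d → ℝ) : Finset (Fin (m + 1) × Fin d) :=
  open Classical in
  Finset.univ.filter fun q => Δ q ≠ 0

/-- The unpenalized coordinates at which `Δ` vanishes (none if `pen = true`). -/
def freeZeros (pen : Bool) (Δ : Fin (m + 1) × Fin d → ℝ) : Finset (Fin (m + 1) × Fin d) :=
  open Classical in
  Finset.univ.filter fun q => IsFree pen q ∧ Δ q = 0

/-- Two edge lists have the same inter-cluster edges in the same positions: as soon as the `l`-th edge
of one of them joins nodes with different coefficient vectors, the two `l`-th edges are equal. -/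
def SameInterCluster (b : Fin (m + 1) → Fin d → ℝ)
    (t t' : Fin m → Fin (m + 1) × Fin (m + 1)) : Prop :=
  ∀ l, (b (t l).1 ≠ b (t l).2 ∨ b (t' l).1 ≠ b (t' l).2) → t l = t' l

end FusedLasso

end

/-! Write `H = H̃ ⊗ I_d` for the (random) difference matrix, `N = K n`, `S = XᵀX / N` for the Gram
matrix of the untransformed design, `G = H⁻ᵀ S H⁻¹` for that of the transformed one, and
`ψ = Xᵀ ε / √N` for the score. "In probability" statements are handled with the filter `whp`
on `ℕ × Ω` of the sequences of events of probability tending to one.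

*Rates.* There are finitely many spanning trees, so `H` and `H⁻¹` are bounded, and `G → C` makes `S`
bounded above and below with high probability. Conditionally on the covariates, Chebyshev's inequality
shows that `ψ` is bounded in probability (`IsNetworkModel.boundedInProb_score`), and by the normal
equations so are the errors `√N (b̂ - β)` of the local estimators
(`IsNetworkModel.boundedInProb_ols`).

*Selection.* The weights of the active coordinates are thus bounded, and comparing the objective at
`Δhat` and at the true differences gives `√N (Δhat - Δ*) = O_P(1)`
(`IsFusedLassoFit.boundedInProb_error`); hence no active coordinate is missed. If a penalized coordinate
with vanishing true difference were non-zero, stationarity would bound `λ_N π_q / √N` by the residual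
correlation `Hᵀ⁻¹ψ - G √N (Δhat - Δ*) = O_P(1)`; but `π_q` is at least of order `N^{γ/2}`, so that
`λ_N N^{(γ-1)/2}` would be bounded in probability (`IsFusedLassoFit.eventually_inactive`).

*Normality.* On the active coordinates the penalty, hence the residual correlation, is `o(√N)`, so
`√N (Δhat - Δ*)_A = C_A⁻¹ (Hᵀ⁻¹ψ)_A + o_P(1)` (`IsFusedLassoFit.tendsto_error_sub`). Here `H` may
depend on the errors even asymptotically, since only the inter-cluster edges of the tree stabilize.
But by the exchange property the minimum spanning tree joins adjacent nodes of a cluster inside the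
cluster (`IsNetworkModel.eventually_isClusterTree`), so the sets of nodes joined by intra-cluster edges
are fixed, and with them the columns of `H⁻¹` with index in `A` (`inv_augIncidence_col_eq`). So
`(Hᵀ⁻¹ψ)_A = Bᵀψ` for a fixed matrix `B`. A linear combination of the entries of `Bᵀψ` is a sum of the
i.i.d. errors with weights independent of them, whose sum of squares converges in probability; this
convergence along all `n` forces the largest weight to be negligible (`eventually_increment_le`), and
the characteristic functions converge to the Gaussian one (`IsNoise.tendsto_integral_exp_sum`). -/

namespace FusedLasso

/-! ### Convergence and boundedness in probability -/

section HighProbability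

variable {Ω : Type*} [MeasurableSpace Ω] {P : Measure Ω}

/-- The filter on `ℕ × Ω` of the sequences of events whose probability tends to one (stated through
the outer measure of the complements, so that no measurability is needed). Convergence in probability
to a constant is convergence along this filter, so that limit theorems for continuous functions apply
to it directly. -/
def whp (P : Measure Ω) : Filter (ℕ × Ω) where
  sets := {E | Tendsto (fun n => P {ω | (n, ω) ∉ E}) atTop (𝓝 0)}
  univ_sets := by simp
  sets_of_superset := by
    intro E F hE hEF
    exact tendsto_of_tendsto_of_tendsto_of_le_of_le tendsto_const_nhds hE (fun _ => zero_le)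
      (fun n => measure_mono fun ω h h' => h (hEF h'))
  inter_sets := by
    intro E F hE hF
    have h := Tendsto.add (show Tendsto (fun n => P {ω | (n, ω) ∉ E}) atTop (𝓝 0) from hE)
      (show Tendsto (fun n => P {ω | (n, ω) ∉ F}) atTop (𝓝 0) from hF)
    rw [add_zero] at h
    refine tendsto_of_tendsto_of_tendsto_of_le_of_le tendsto_const_nhds h (fun _ => zero_le)
      (fun n => (measure_mono ?_).trans (measure_union_le _ _))
    intro ω hω
    by_contra hc
    simp only [Set.mem_union, Set.mem_ofPred_eq, not_or, not_not] at hc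
    exact hω hc

lemma eventually_whp {Q : ℕ × Ω → Prop} :
    (∀ᶠ p in whp P, Q p) ↔ Tendsto (fun n => P {ω | ¬ Q (n, ω)}) atTop (𝓝 0) := Iff.rfl

lemma tendstoInMeasure_iff_tendsto_whp {E : Type*} [PseudoMetricSpace E] {f : ℕ → Ω → E} {c : E} :
    TendstoInMeasure P f atTop (fun _ => c) ↔
      Tendsto (fun p : ℕ × Ω => f p.1 p.2) (whp P) (𝓝 c) := by
  rw [tendstoInMeasure_iff_dist, Metric.tendsto_nhds]
  simp only [eventually_whp, not_lt]

lemma tendsto_fst_whp : Tendsto Prod.fst (whp P) atTop := by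
  rw [tendsto_atTop]
  intro b
  rw [eventually_whp]
  refine tendsto_const_nhds.congr' ?_
  filter_upwards [eventually_ge_atTop b] with n hn
  simp [hn]

instance [IsProbabilityMeasure P] : (whp P).NeBot := by
  rw [neBot_iff, Ne, ← empty_mem_iff_bot]
  intro h
  have h' : Tendsto (fun _ : ℕ => P Set.univ) atTop (𝓝 0) := by
    simpa using (show Tendsto (fun n => P {ω | (n, ω) ∉ (∅ : Set (ℕ × Ω))}) atTop (𝓝 0) from h)
  have := tendsto_nhds_unique h' tendsto_const_nhds
  simp at this

/-- Boundedness in probability (tightness) of a sequence of real random variables. -/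
def BoundedInProb (P : Measure Ω) (f : ℕ × Ω → ℝ) : Prop :=
  ∀ δ : ℝ≥0∞, 0 < δ → ∃ M : ℝ, ∀ᶠ n in atTop, P {ω | M < |f (n, ω)|} ≤ δ

lemma BoundedInProb.eventually_le {f : ℕ × Ω → ℝ} (hf : BoundedInProb P f) {M : ℕ → ℝ}
    (hM : Tendsto M atTop atTop) : ∀ᶠ p in whp P, |f p| ≤ M p.1 := by
  rw [eventually_whp, ENNReal.tendsto_atTop_zero]
  intro δ hδ
  obtain ⟨K, hK⟩ := hf δ hδ
  rw [← eventually_atTop]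
  filter_upwards [hK, hM.eventually_ge_atTop K] with n h1 h2
  refine (measure_mono fun ω hω => ?_).trans h1
  simp only [Set.mem_ofPred_eq, not_le] at hω ⊢
  exact h2.trans_lt hω

lemma BoundedInProb.of_le {f g : ℕ × Ω → ℝ} (hf : BoundedInProb P f) {c b : ℝ} (hc : 0 ≤ c)
    (h : ∀ᶠ p in whp P, |g p| ≤ c * |f p| + b) : BoundedInProb P g := by
  intro δ hδ
  obtain ⟨K, hK⟩ := hf (δ / 2) (ENNReal.half_pos hδ.ne')
  have h2 := (ENNReal.tendsto_atTop_zero.1 (eventually_whp.1 h)) (δ / 2) (ENNReal.half_pos hδ.ne')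
  rw [← eventually_atTop] at h2
  refine ⟨c * K + b, ?_⟩
  filter_upwards [hK, h2] with n h1 h2
  refine (measure_mono fun ω hω => ?_).trans
    ((measure_union_le {ω | K < |f (n, ω)|} {ω | ¬ |g (n, ω)| ≤ c * |f (n, ω)| + b}).trans
      ((add_le_add h1 h2).trans_eq (ENNReal.add_halves δ)))
  by_contra hcon
  simp only [Set.mem_union, Set.mem_ofPred_eq, not_or, not_not, not_lt] at hcon hω
  have := mul_le_mul_of_nonneg_left hcon.1 hc
  linarith [hcon.2]

lemma BoundedInProb.add {f g : ℕ × Ω → ℝ} (hf : BoundedInProb P f) (hg : BoundedInProb P g) :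
    BoundedInProb P fun p => f p + g p := by
  intro δ hδ
  obtain ⟨K, hK⟩ := hf (δ / 2) (ENNReal.half_pos hδ.ne')
  obtain ⟨K', hK'⟩ := hg (δ / 2) (ENNReal.half_pos hδ.ne')
  refine ⟨K + K', ?_⟩
  filter_upwards [hK, hK'] with n h1 h2
  refine (measure_mono fun ω hω => ?_).trans
    ((measure_union_le {ω | K < |f (n, ω)|} {ω | K' < |g (n, ω)|}).trans
      ((add_le_add h1 h2).trans_eq (ENNReal.add_halves δ)))
  by_contra hcon
  simp only [Set.mem_union, Set.mem_ofPred_eq, not_or, not_lt] at hcon hω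
  linarith [abs_add_le (f (n, ω)) (g (n, ω)), hcon.1, hcon.2]

lemma BoundedInProb.tendsto_mul_zero {f g : ℕ × Ω → ℝ} (hf : BoundedInProb P f)
    (hg : Tendsto g (whp P) (𝓝 0)) : Tendsto (fun p => g p * f p) (whp P) (𝓝 0) := by
  rw [Metric.tendsto_nhds]
  intro η hη
  rw [eventually_whp, ENNReal.tendsto_atTop_zero]
  intro δ hδ
  rw [← eventually_atTop]
  obtain ⟨K, hK⟩ := hf (δ / 2) (ENNReal.half_pos hδ.ne')
  have h3 : 0 < η / (|K| + 1) := by positivity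
  have h2 := (ENNReal.tendsto_atTop_zero.1 (eventually_whp.1 (Metric.tendsto_nhds.1 hg _ h3)))
    (δ / 2) (ENNReal.half_pos hδ.ne')
  rw [← eventually_atTop] at h2
  filter_upwards [hK, h2] with n h1 h2
  refine (measure_mono fun ω hω => ?_).trans
    ((measure_union_le _ _).trans ((add_le_add h1 h2).trans_eq (ENNReal.add_halves δ)))
  by_contra hcon
  simp only [Set.mem_union, Set.mem_ofPred_eq, not_or, not_lt, dist_zero_right,
    Real.norm_eq_abs, abs_mul, not_le] at hcon hω
  have h4 : |f (n, ω)| ≤ |K| + 1 := by linarith [hcon.1, le_abs_self K]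
  have h5 : |g (n, ω)| * |f (n, ω)| ≤ |g (n, ω)| * (|K| + 1) :=
    mul_le_mul_of_nonneg_left h4 (abs_nonneg _)
  have h6 := (lt_div_iff₀ (show (0 : ℝ) < |K| + 1 by positivity)).1 hcon.2
  linarith

lemma BoundedInProb.norm_pi {ι : Type*} [Fintype ι] {f : ℕ × Ω → ι → ℝ}
    (hf : ∀ q, BoundedInProb P fun p => f p q) : BoundedInProb P fun p => ‖f p‖ := by
  intro δ hδ
  have hδ' : 0 < δ / ((Fintype.card ι : ℝ≥0∞) + 1) := by
    refine ENNReal.div_pos hδ.ne' ?_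
    exact ENNReal.add_ne_top.2 ⟨ENNReal.natCast_ne_top _, ENNReal.one_ne_top⟩
  choose K hK using fun q => hf q _ hδ'
  refine ⟨∑ q, |K q|, ?_⟩
  filter_upwards [eventually_all.2 hK] with n hn
  calc P {ω | ∑ q, |K q| < |‖f (n, ω)‖|} ≤ P (⋃ q, {ω | K q < |f (n, ω) q|}) := by
        refine measure_mono fun ω hω => ?_
        by_contra hcon
        simp only [Set.mem_iUnion, Set.mem_ofPred_eq, not_exists, not_lt, abs_norm] at hcon hω
        refine absurd hω (not_lt.2 ?_)
        rw [pi_norm_le_iff_of_nonneg (Finset.sum_nonneg fun _ _ => abs_nonneg _)]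
        intro q
        rw [Real.norm_eq_abs]
        exact ((hcon q).trans (le_abs_self _)).trans
          (Finset.single_le_sum (f := fun q => |K q|) (fun _ _ => abs_nonneg _) (Finset.mem_univ q))
    _ ≤ ∑ q, P {ω | K q < |f (n, ω) q|} := measure_iUnion_fintype_le _ _
    _ ≤ ∑ _q : ι, δ / ((Fintype.card ι : ℝ≥0∞) + 1) := Finset.sum_le_sum fun q _ => hn q
    _ = Fintype.card ι * (δ / ((Fintype.card ι : ℝ≥0∞) + 1)) := by simp
    _ ≤ ((Fintype.card ι : ℝ≥0∞) + 1) * (δ / ((Fintype.card ι : ℝ≥0∞) + 1)) := by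
        gcongr; simp
    _ = δ := ENNReal.mul_div_cancel (by simp)
        (ENNReal.add_ne_top.2 ⟨ENNReal.natCast_ne_top _, ENNReal.one_ne_top⟩)

lemma tendsto_measure_one_of_eventually_whp [IsProbabilityMeasure P] {Q : ℕ × Ω → Prop}
    (h : ∀ᶠ p in whp P, Q p) : Tendsto (fun n => P {ω | Q (n, ω)}) atTop (𝓝 1) := by
  have h1 := ENNReal.Tendsto.sub (tendsto_const_nhds (x := (1 : ℝ≥0∞)) (f := atTop))
    (eventually_whp.1 h) (Or.inl ENNReal.one_ne_top)
  rw [tsub_zero] at h1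
  refine tendsto_of_tendsto_of_tendsto_of_le_of_le h1 tendsto_const_nhds (fun n => ?_)
    (fun n => prob_le_one)
  rw [tsub_le_iff_right, ← measure_univ (μ := P)]
  refine (measure_mono fun ω _ => ?_).trans (measure_union_le _ _)
  exact em (Q (n, ω))

/-- The converse direction needs measurability, the complement of a set of full outer measure being
possibly of positive outer measure. -/
lemma eventually_whp_of_tendsto_measure_one [IsProbabilityMeasure P] {Q : ℕ × Ω → Prop}
    (hQ : ∀ n, MeasurableSet {ω | Q (n, ω)})
    (h : Tendsto (fun n => P {ω | Q (n, ω)}) atTop (𝓝 1)) : ∀ᶠ p in whp P, Q p := by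
  rw [eventually_whp]
  have h1 := ENNReal.Tendsto.sub (tendsto_const_nhds (x := (1 : ℝ≥0∞)) (f := atTop))
    h (Or.inl ENNReal.one_ne_top)
  rw [tsub_self] at h1
  refine h1.congr fun n => ?_
  rw [← prob_compl_eq_one_sub (hQ n)]
  rfl

/-- Bounded convergence for convergence in probability to a constant. -/
lemma tendsto_integral_of_tendsto_whp [IsProbabilityMeasure P] {f : ℕ → Ω → ℂ} {c : ℂ}
    (hmeas : ∀ n, Measurable (f n)) (hbound : ∀ n ω, ‖f n ω‖ ≤ 1)
    (h : Tendsto (fun p : ℕ × Ω => f p.1 p.2) (whp P) (𝓝 c)) :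
    Tendsto (fun n => ∫ ω, f n ω ∂P) atTop (𝓝 c) := by
  have hm := tendstoInMeasure_iff_tendsto_whp.2 h
  refine tendsto_of_subseq_tendsto fun ns hns => ?_
  obtain ⟨ms, -, hms⟩ := (hm.comp hns).exists_seq_tendsto_ae
  refine ⟨ms, ?_⟩
  have hc : c = ∫ _ω, c ∂P := by simp
  rw [hc]
  refine tendsto_integral_of_dominated_convergence (fun _ => 1)
    (fun n => (hmeas _).aestronglyMeasurable) (integrable_const _)
    (fun n => Eventually.of_forall fun ω => hbound _ ω) hms

end HighProbability

/-! ### Weighted sums of independent errors -/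

section Noise

variable {Ω : Type*} [MeasurableSpace Ω] {P : Measure Ω} [IsProbabilityMeasure P] {J : Type*}

/-- The family `ε` consists of i.i.d. centred square integrable variables of variance `σ ^ 2`. -/
structure IsNoise (P : Measure Ω) (ε : J → Ω → ℝ) (σ : ℝ) : Prop where
  measurable : ∀ j, Measurable (ε j)
  indep : iIndepFun ε P
  ident : ∀ j j', IdentDistrib (ε j) (ε j') P P
  memLp : ∀ j, MemLp (ε j) 2 P
  mean : ∀ j, ∫ ω, ε j ω ∂P = 0
  var : ∀ j, variance (ε j) P = σ ^ 2

variable {𝓧 : Type*} [MeasurableSpace 𝓧] {ε : J → Ω → ℝ} {σ : ℝ} {X : Ω → 𝓧}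

/-- A bound on the probability of an event that holds for every frozen value of `X` also holds if `X` is
random and independent of `E`, by Fubini's theorem. -/
lemma measure_le_of_indepFun {𝓔 : Type*} [MeasurableSpace 𝓔] {E : Ω → 𝓔} (hX : Measurable X)
    (hE : Measurable E) (hXE : IndepFun X E P) {B : Set (𝓧 × 𝓔)} (hB : MeasurableSet B) {r : ℝ≥0∞}
    (h : ∀ x, P {ω | (x, E ω) ∈ B} ≤ r) : P {ω | (X ω, E ω) ∈ B} ≤ r := by
  have h1 : P {ω | (X ω, E ω) ∈ B} = P.map (fun ω => (X ω, E ω)) B := by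
    rw [Measure.map_apply (hX.prodMk hE) hB]; rfl
  have : IsProbabilityMeasure (P.map X) := Measure.isProbabilityMeasure_map hX.aemeasurable
  have : IsProbabilityMeasure (P.map E) := Measure.isProbabilityMeasure_map hE.aemeasurable
  rw [h1, hXE.map_prod_eq_prod_map_map hX.aemeasurable hE.aemeasurable, Measure.prod_apply hB]
  calc ∫⁻ x, P.map E (Prod.mk x ⁻¹' B) ∂P.map X ≤ ∫⁻ _x, r ∂P.map X := by
        refine lintegral_mono fun x => ?_
        rw [Measure.map_apply hE (measurable_prodMk_left hB)]
        exact h x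
    _ = r := by simp

lemma integral_comp_of_indepFun {𝓔 : Type*} [MeasurableSpace 𝓔] {E : Ω → 𝓔} (hX : Measurable X)
    (hE : Measurable E) (hXE : IndepFun X E P) {f : 𝓧 × 𝓔 → ℂ} (hf : Measurable f)
    (hb : ∀ z, ‖f z‖ ≤ 1) :
    ∫ ω, f (X ω, E ω) ∂P = ∫ ω, ∫ ω', f (X ω, E ω') ∂P ∂P := by
  have : IsProbabilityMeasure (P.map X) := Measure.isProbabilityMeasure_map hX.aemeasurable
  have : IsProbabilityMeasure (P.map E) := Measure.isProbabilityMeasure_map hE.aemeasurable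
  rw [← integral_map (φ := fun ω => (X ω, E ω)) (hX.prodMk hE).aemeasurable
    hf.aestronglyMeasurable, hXE.map_prod_eq_prod_map_map hX.aemeasurable hE.aemeasurable,
    integral_prod _ (Integrable.of_bound hf.aestronglyMeasurable 1 (Eventually.of_forall hb)),
    integral_map hX.aemeasurable]
  · congr 1 with ω
    rw [integral_map hE.aemeasurable]
    exact (hf.comp measurable_prodMk_left).aestronglyMeasurable
  · exact (hf.stronglyMeasurable.integral_prod_right').aestronglyMeasurable

lemma IsNoise.measure_sum_le (h : IsNoise P ε σ) (s : Finset J) (c : J → ℝ) {M : ℝ} (hM : 0 < M) :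
    P {ω | M < |∑ j ∈ s, c j * ε j ω|} ≤ ENNReal.ofReal (σ ^ 2 * ∑ j ∈ s, c j ^ 2 / M ^ 2) := by
  have hL : ∀ j ∈ s, MemLp (fun ω => c j * ε j ω) 2 P := fun j _ => (h.memLp j).const_mul (c j)
  have hmean : ∫ ω, ∑ j ∈ s, c j * ε j ω ∂P = 0 := by
    rw [integral_finsetSum _ fun j hj => (hL j hj).integrable (by norm_num)]
    simp [integral_const_mul, h.mean]
  have hvar : variance (fun ω => ∑ j ∈ s, c j * ε j ω) P = σ ^ 2 * ∑ j ∈ s, c j ^ 2 := by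
    have h1 := IndepFun.variance_sum (X := fun j ω => c j * ε j ω) (s := s) hL (by
      intro i _ j _ hij
      exact (h.indep.indepFun hij).comp (measurable_const_mul (c i)) (measurable_const_mul (c j)))
    have h2 : (∑ j ∈ s, fun ω => c j * ε j ω) = fun ω => ∑ j ∈ s, c j * ε j ω := by
      ext ω; simp
    rw [h2] at h1
    rw [h1, Finset.mul_sum]
    refine Finset.sum_congr rfl fun j _ => ?_
    rw [variance_const_mul, h.var]; ring
  have h3 := meas_ge_le_variance_div_sq (memLp_finsetSum s hL) hM
  rw [hmean, hvar] at h3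
  refine (measure_mono fun ω hω => ?_).trans (h3.trans_eq ?_)
  · simpa using le_of_lt hω
  · rw [← Finset.sum_div, mul_div_assoc]

/-- Weighted sums of the errors are bounded in probability as soon as the sum of the squared weights,
which may depend on the covariates, is bounded with high probability: by independence Chebyshev's
inequality can be applied with frozen weights. -/
lemma IsNoise.boundedInProb_sum (h : IsNoise P ε σ) (hX : Measurable X)
    (hXε : IndepFun X (fun ω j => ε j ω) P) (s : ℕ → Finset J) {c : ℕ → J → 𝓧 → ℝ}
    (hc : ∀ n j, Measurable (c n j)) (K : ℝ)
    (hK : ∀ᶠ p : ℕ × Ω in whp P, ∑ j ∈ s p.1, c p.1 j (X p.2) ^ 2 ≤ K) :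
    BoundedInProb P fun p => ∑ j ∈ s p.1, c p.1 j (X p.2) * ε j p.2 := by
  intro δ hδ
  have hlim : Tendsto (fun M : ℝ => ENNReal.ofReal (σ ^ 2 * |K| / M ^ 2)) atTop (𝓝 0) := by
    rw [← ENNReal.ofReal_zero]
    refine ENNReal.tendsto_ofReal ?_
    exact tendsto_const_nhds.div_atTop (tendsto_pow_atTop two_ne_zero)
  obtain ⟨M, hM, hM0⟩ := ((hlim.eventually (gt_mem_nhds (ENNReal.half_pos hδ.ne'))).and
    (eventually_gt_atTop 0)).exists
  refine ⟨M, ?_⟩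
  have h2 := (ENNReal.tendsto_atTop_zero.1 (eventually_whp.1 hK)) (δ / 2) (ENNReal.half_pos hδ.ne')
  rw [← eventually_atTop] at h2
  filter_upwards [h2] with n hn
  have hE : Measurable fun ω j => ε j ω := measurable_pi_lambda _ h.measurable
  let B : Set (𝓧 × (J → ℝ)) :=
    {z | ∑ j ∈ s n, c n j z.1 ^ 2 ≤ |K| ∧ M < |∑ j ∈ s n, c n j z.1 * z.2 j|}
  have hB : MeasurableSet B := by
    refine MeasurableSet.inter ?_ ?_
    · have h1 : Measurable fun z : 𝓧 × (J → ℝ) => ∑ j ∈ s n, c n j z.1 ^ 2 :=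
        Finset.measurable_sum _ fun j _ => ((hc n j).comp measurable_fst).pow_const 2
      exact measurableSet_le h1 measurable_const
    · have h1 : Measurable fun z : 𝓧 × (J → ℝ) => ∑ j ∈ s n, c n j z.1 * z.2 j :=
        Finset.measurable_sum _ fun j _ =>
          ((hc n j).comp measurable_fst).mul ((measurable_pi_apply j).comp measurable_snd)
      exact measurableSet_lt measurable_const h1.abs
  have h1 : P {ω | (X ω, fun j => ε j ω) ∈ B} ≤ δ / 2 := by
    refine measure_le_of_indepFun hX hE hXε hB fun x => ?_
    by_cases hx : ∑ j ∈ s n, c n j x ^ 2 ≤ |K|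
    · refine (measure_mono fun ω hω => hω.2).trans
        ((h.measure_sum_le (s n) (fun j => c n j x) hM0).trans ?_)
      refine (ENNReal.ofReal_le_ofReal ?_).trans hM.le
      rw [← Finset.sum_div, ← mul_div_assoc]
      gcongr
    · have : {ω | (x, fun j => ε j ω) ∈ B} = ∅ := by
        ext ω; simp [B, hx]
      simp [this]
  refine (measure_mono fun ω hω => ?_).trans
    ((measure_union_le _ _).trans ((add_le_add h1 hn).trans_eq (ENNReal.add_halves δ)))
  by_cases hω' : ∑ j ∈ s n, c n j (X ω) ^ 2 ≤ K
  · exact Or.inl ⟨hω'.trans (le_abs_self K), hω⟩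
  · exact Or.inr hω'

end Noise

/-! ### A central limit theorem for random weights -/

section WeightedCLT

variable {Ω : Type*} [MeasurableSpace Ω] {P : Measure Ω} {J : Type*}
  {𝓧 : Type*} [MeasurableSpace 𝓧] {ε : J → Ω → ℝ} {σ : ℝ} {X : Ω → 𝓧}

lemma norm_prod_sub_prod_le (s : Finset J) {z w : J → ℂ} (hz : ∀ j ∈ s, ‖z j‖ ≤ 1)
    (hw : ∀ j ∈ s, ‖w j‖ ≤ 1) : ‖∏ j ∈ s, z j - ∏ j ∈ s, w j‖ ≤ ∑ j ∈ s, ‖z j - w j‖ := by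
  classical
  induction s using Finset.induction_on with
  | empty => simp
  | insert a s ha ih =>
    rw [Finset.prod_insert ha, Finset.prod_insert ha, Finset.sum_insert ha]
    have h1 := ih (fun j hj => hz j (Finset.mem_insert_of_mem hj))
      (fun j hj => hw j (Finset.mem_insert_of_mem hj))
    have h2 : ‖∏ j ∈ s, z j‖ ≤ 1 := by
      rw [norm_prod]
      exact Finset.prod_le_one (fun _ _ => norm_nonneg _)
        fun j hj => hz j (Finset.mem_insert_of_mem hj)
    have h3 : z a * ∏ j ∈ s, z j - w a * ∏ j ∈ s, w j =
        (z a - w a) * ∏ j ∈ s, z j + w a * (∏ j ∈ s, z j - ∏ j ∈ s, w j) := by ring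
    rw [h3]
    refine (norm_add_le _ _).trans ?_
    rw [norm_mul, norm_mul]
    have h4 := mul_le_mul_of_nonneg_left h2 (norm_nonneg (z a - w a))
    have h5 := mul_le_mul_of_nonneg_right (hw a (Finset.mem_insert_self a s))
      (norm_nonneg (∏ j ∈ s, z j - ∏ j ∈ s, w j))
    linarith

lemma IsNoise.integral_exp_sum (h : IsNoise P ε σ) (j₀ : J) (s : Finset J) (c : J → ℝ) :
    ∫ ω, Complex.exp ((∑ j ∈ s, c j * ε j ω : ℝ) * Complex.I) ∂P =
      ∏ j ∈ s, charFun (P.map (ε j₀)) (c j) := by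
  have hm : ∀ j, Measurable fun ω => c j * ε j ω := fun j => (h.measurable j).const_mul (c j)
  have hind : iIndepFun (fun j ω => c j * ε j ω) P :=
    h.indep.comp (fun j x => c j * x) fun j => measurable_const_mul (c j)
  have h1 := (hind.restrict s).charFun_map_fun_finsetSum_eq_prod (fun j _ => (hm j).aemeasurable)
  have h2 := congrFun h1 1
  rw [charFun_apply_real, integral_map (Finset.measurable_sum _ fun j _ => hm j).aemeasurable
    (by fun_prop), Finset.prod_apply] at h2
  convert! h2 using 1
  · simp
  · refine Finset.prod_congr rfl fun j _ => ?_
    rw [charFun_map_mul_comp (h.measurable j).aemeasurable, mul_one, (h.ident j j₀).map_eq]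

variable [IsProbabilityMeasure P]

lemma IsNoise.charFun_isLittleO (h : IsNoise P ε σ) (j : J) :
    (fun t : ℝ => charFun (P.map (ε j)) t - (1 - σ ^ 2 * t ^ 2 / 2)) =o[𝓝 0] fun t => t ^ 2 := by
  have hX : AEMeasurable (ε j) P := (h.measurable j).aemeasurable
  have hprob : IsProbabilityMeasure (P.map (ε j)) := Measure.isProbabilityMeasure_map hX
  have hint : MemLp id 2 (P.map (ε j)) :=
    (memLp_map_measure_iff aestronglyMeasurable_id hX).2 (h.memLp j)
  have hsq : P[ε j ^ 2] = σ ^ 2 := by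
    rw [← h.var j, variance_of_integral_eq_zero hX (h.mean j)]
    simp
  have h1 : ∀ t : ℝ, (1 - σ ^ 2 * t ^ 2 / 2 : ℂ) =
      taylorWithinEval (charFun (P.map (ε j))) 2 Set.univ 0 t := by
    intro t
    rw [taylorWithinEval_charFun_two_zero hX hint, hsq, h.mean j]
    simp
  simp_rw [h1]
  convert! taylor_isLittleO_univ (contDiff_charFun hint) using 2
  simp

/-- A central limit theorem for weighted sums of i.i.d. errors whose weights depend on independent
covariates: it suffices that the sum of the squared weights converges in probability and that the
largest weight is negligible. Conditionally on the covariates, the characteristic function is a product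
that is compared factor by factor with that of the Gaussian law. -/
lemma IsNoise.tendsto_integral_exp_sum (h : IsNoise P ε σ) (hX : Measurable X)
    (hXε : IndepFun X (fun ω j => ε j ω) P) (j₀ : J) (s : ℕ → Finset J) {c : ℕ → J → 𝓧 → ℝ}
    (hc : ∀ n j, Measurable (c n j)) {τ : ℝ}
    (hsum : Tendsto (fun p : ℕ × Ω => ∑ j ∈ s p.1, c p.1 j (X p.2) ^ 2) (whp P) (𝓝 τ))
    (hmax : ∀ η > 0, ∀ᶠ p : ℕ × Ω in whp P, ∀ j ∈ s p.1, |c p.1 j (X p.2)| ≤ η) :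
    Tendsto (fun n => ∫ ω, Complex.exp ((∑ j ∈ s n, c n j (X ω) * ε j ω : ℝ) * Complex.I) ∂P)
      atTop (𝓝 (Complex.exp (-(σ ^ 2 * τ / 2 : ℝ)))) := by
  set φ := charFun (P.map (ε j₀)) with hφ
  have hprob : IsProbabilityMeasure (P.map (ε j₀)) :=
    Measure.isProbabilityMeasure_map (h.measurable j₀).aemeasurable
  have hφ1 : ∀ t, ‖φ t‖ ≤ 1 := fun t => norm_charFun_le_one t
  have hφm : Measurable φ := measurable_charFun
  have hE : Measurable fun ω j => ε j ω := measurable_pi_lambda _ h.measurable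
  have hcond : ∀ n, ∫ ω, Complex.exp ((∑ j ∈ s n, c n j (X ω) * ε j ω : ℝ) * Complex.I) ∂P =
      ∫ ω, ∏ j ∈ s n, φ (c n j (X ω)) ∂P := by
    intro n
    have hf : Measurable fun z : 𝓧 × (J → ℝ) =>
        Complex.exp ((∑ j ∈ s n, c n j z.1 * z.2 j : ℝ) * Complex.I) := by
      have h1 : Measurable fun z : 𝓧 × (J → ℝ) => ∑ j ∈ s n, c n j z.1 * z.2 j :=
        Finset.measurable_sum _ fun j _ =>
          ((hc n j).comp measurable_fst).mul ((measurable_pi_apply j).comp measurable_snd)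
      exact Complex.measurable_exp.comp ((Complex.measurable_ofReal.comp h1).mul_const _)
    rw [integral_comp_of_indepFun (f := fun z : 𝓧 × (J → ℝ) =>
        Complex.exp ((∑ j ∈ s n, c n j z.1 * z.2 j : ℝ) * Complex.I)) hX hE hXε hf
        fun z => (Complex.norm_exp_ofReal_mul_I _).le]
    congr 1 with ω
    exact h.integral_exp_sum j₀ (s n) fun j => c n j (X ω)
  simp_rw [hcond]
  refine tendsto_integral_of_tendsto_whp
    (fun n => Finset.measurable_prod _ fun j _ => hφm.comp ((hc n j).comp hX)) (fun n ω => ?_) ?_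
  · rw [norm_prod]
    exact Finset.prod_le_one (fun _ _ => norm_nonneg _) fun j _ => hφ1 _
  -- the Gaussian factors have the right limit, and they differ little from the factors `φ`
  let g : ℝ → ℂ := fun t => Complex.exp (-(σ ^ 2 * t ^ 2 / 2 : ℝ))
  have hg1 : ∀ t, ‖g t‖ ≤ 1 := by
    intro t
    rw [Complex.norm_exp]
    simp only [Complex.neg_re, Complex.ofReal_re, Real.exp_le_one_iff]
    have : 0 ≤ σ ^ 2 * t ^ 2 / 2 := by positivity
    linarith
  have hgprod : ∀ p : ℕ × Ω, ∏ j ∈ s p.1, g (c p.1 j (X p.2)) =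
      Complex.exp (-(σ ^ 2 * (∑ j ∈ s p.1, c p.1 j (X p.2) ^ 2) / 2 : ℝ)) := by
    intro p
    rw [← Complex.exp_sum, Finset.mul_sum, Finset.sum_div, Complex.ofReal_sum,
      ← Finset.sum_neg_distrib]
  have hglim : Tendsto (fun p : ℕ × Ω => ∏ j ∈ s p.1, g (c p.1 j (X p.2))) (whp P)
      (𝓝 (Complex.exp (-(σ ^ 2 * τ / 2 : ℝ)))) := by
    simp_rw [hgprod]
    have hcont : Continuous fun r : ℝ => Complex.exp (-(σ ^ 2 * r / 2 : ℝ)) := by fun_prop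
    exact (hcont.tendsto τ).comp hsum
  have hφg : (fun t : ℝ => φ t - g t) =o[𝓝 0] fun t => t ^ 2 := by
    have h1 : (fun t : ℝ => g t - (1 - σ ^ 2 * t ^ 2 / 2)) =o[𝓝 0] fun t : ℝ => t ^ 2 := by
      have h2 : (fun x : ℂ => Complex.exp x - 1 - x) =o[𝓝 0] fun x : ℂ => x := by
        have := (hasDerivAt_iff_isLittleO.1 (Complex.hasDerivAt_exp 0))
        simpa using this
      have h3 : Tendsto (fun t : ℝ => ((-(σ ^ 2 * t ^ 2 / 2 : ℝ) : ℝ) : ℂ)) (𝓝 0) (𝓝 0) := by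
        have hcont : Continuous fun t : ℝ => ((-(σ ^ 2 * t ^ 2 / 2 : ℝ) : ℝ) : ℂ) := by fun_prop
        simpa using hcont.tendsto 0
      have h4 := h2.comp_tendsto h3
      have h5 : ((fun x : ℂ => x) ∘ fun t : ℝ => ((-(σ ^ 2 * t ^ 2 / 2 : ℝ) : ℝ) : ℂ))
          =O[𝓝 0] fun t : ℝ => t ^ 2 := by
        refine Asymptotics.IsBigO.of_bound (σ ^ 2 / 2) (Eventually.of_forall fun t => ?_)
        simp only [Function.comp, Complex.norm_real, norm_neg]
        rw [Real.norm_of_nonneg (by positivity), Real.norm_of_nonneg (by positivity)]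
        exact le_of_eq (by ring)
      refine (h4.trans_isBigO h5).congr_left fun t => ?_
      simp only [Function.comp, g]
      push_cast
      ring
    refine ((h.charFun_isLittleO j₀).sub h1).congr_left fun t => ?_
    ring
  have hdiff : Tendsto (fun p : ℕ × Ω => ∏ j ∈ s p.1, φ (c p.1 j (X p.2)) -
      ∏ j ∈ s p.1, g (c p.1 j (X p.2))) (whp P) (𝓝 0) := by
    rw [Metric.tendsto_nhds]
    intro η hη
    have hτ : 0 < η / (|τ| + 2) := by positivity
    obtain ⟨r, hr, hr'⟩ := Metric.eventually_nhds_iff.1 (hφg.def hτ)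
    have hle : ∀ᶠ p : ℕ × Ω in whp P, ∑ j ∈ s p.1, c p.1 j (X p.2) ^ 2 < |τ| + 1 :=
      hsum.eventually (gt_mem_nhds (by linarith [le_abs_self τ]))
    filter_upwards [hle, hmax (r / 2) (by positivity)] with p h1 h2
    rw [dist_zero_right]
    refine (norm_prod_sub_prod_le _ (fun _ _ => hφ1 _) (fun _ _ => hg1 _)).trans_lt ?_
    calc ∑ j ∈ s p.1, ‖φ (c p.1 j (X p.2)) - g (c p.1 j (X p.2))‖
        ≤ ∑ j ∈ s p.1, η / (|τ| + 2) * c p.1 j (X p.2) ^ 2 := by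
          refine Finset.sum_le_sum fun j hj => ?_
          have h3 := hr' (y := c p.1 j (X p.2)) (by
            rw [dist_zero_right, Real.norm_eq_abs]
            linarith [h2 j hj])
          rwa [Real.norm_of_nonneg (sq_nonneg (c p.1 j (X p.2)))] at h3
      _ = η / (|τ| + 2) * ∑ j ∈ s p.1, c p.1 j (X p.2) ^ 2 := by rw [Finset.mul_sum]
      _ ≤ η / (|τ| + 2) * (|τ| + 1) := by gcongr
      _ < η := by
          rw [div_mul_eq_mul_div, div_lt_iff₀ (by positivity)]
          nlinarith
  simpa using hdiff.add hglim

end WeightedCLT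

section Increments

variable {Ω : Type*} [MeasurableSpace Ω] {P : Measure Ω}

/-- If the averages `S n / n` of a nondecreasing sequence converge in probability, then the largest
increment up to `n` is negligible compared to `n`. Cut `{0, …, n}` into `r` blocks of nearly equal
length: each increment is at most the growth of `S` over one of the blocks, which is about `τ n / r`. -/
lemma eventually_increment_le {S : ℕ → Ω → ℝ} (hS0 : ∀ ω, S 0 ω = 0)
    (hmono : ∀ ω, Monotone fun n => S n ω) {τ : ℝ}
    (hS : Tendsto (fun p : ℕ × Ω => S p.1 p.2 / p.1) (whp P) (𝓝 τ)) {η : ℝ} (hη : 0 < η) :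
    ∀ᶠ p : ℕ × Ω in whp P, ∀ i < p.1, S (i + 1) p.2 - S i p.2 ≤ η * p.1 := by
  obtain ⟨r, hr⟩ := exists_nat_gt (|τ| / η)
  have hr0 : (0 : ℝ) < r := lt_of_le_of_lt (by positivity) hr
  have hr0' : 0 < r := by exact_mod_cast hr0
  have hlim : ∀ j : ℕ, Tendsto (fun p : ℕ × Ω => S (j * p.1 / r) p.2 / p.1) (whp P)
      (𝓝 (τ * (j / r))) := by
    intro j
    rcases Nat.eq_zero_or_pos j with rfl | hj
    · simp [hS0, tendsto_const_nhds]
    have hratio : Tendsto (fun n : ℕ => ((j * n / r : ℕ) : ℝ) / n) atTop (𝓝 (j / r)) := by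
      have h1 : Tendsto (fun n : ℕ => (⌊(j / r : ℝ) * n⌋₊ : ℝ) / n) atTop (𝓝 (j / r)) :=
        (tendsto_nat_floor_mul_div_atTop (by positivity)).comp tendsto_natCast_atTop_atTop
      refine h1.congr fun n => ?_
      rw [← Nat.floor_div_eq_div (K := ℝ), div_mul_eq_mul_div]
      push_cast
      rfl
    have hk : Tendsto (fun n : ℕ => j * n / r) atTop atTop := by
      refine tendsto_atTop.2 fun b => ?_
      filter_upwards [eventually_ge_atTop (b * r)] with n hn
      rw [Nat.le_div_iff_mul_le hr0']
      nlinarith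
    have h2 := tendstoInMeasure_iff_tendsto_whp.1
      ((tendstoInMeasure_iff_tendsto_whp (P := P) (f := fun n ω => S n ω / n)).2 hS |>.comp hk)
    refine (h2.mul (hratio.comp tendsto_fst_whp)).congr' ?_
    filter_upwards [tendsto_fst_whp.eventually (hk.eventually_gt_atTop 0)] with p hp
    have : ((j * p.1 / r : ℕ) : ℝ) ≠ 0 := by exact_mod_cast hp.ne'
    simp only [Function.comp]
    rw [div_mul_div_comm, mul_comm (S _ _), mul_div_mul_left _ _ this]
  have hblock : ∀ᶠ p : ℕ × Ω in whp P, ∀ j ∈ Finset.range r,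
      S ((j + 1) * p.1 / r) p.2 / p.1 - S (j * p.1 / r) p.2 / p.1 < η := by
    rw [eventually_all_finset]
    intro j _
    refine ((hlim (j + 1)).sub (hlim j)).eventually (gt_mem_nhds ?_)
    have : τ * ((j + 1 : ℕ) / r) - τ * (j / r) = τ / r := by push_cast; field_simp; ring
    rw [this, div_lt_iff₀ hr0]
    rw [div_lt_iff₀ hη] at hr
    linarith [le_abs_self τ]
  filter_upwards [hblock] with p hp i hi
  have hn : (0 : ℝ) < p.1 := by exact_mod_cast (Nat.zero_le i).trans_lt hi
  have hex : ∃ j, i < (j + 1) * p.1 / r := by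
    refine ⟨r - 1, ?_⟩
    rwa [Nat.sub_add_cancel hr0', Nat.mul_div_cancel_left _ hr0']
  classical
  have h1 := Nat.find_spec hex
  set j := Nat.find hex with hj
  have hjr : j < r := by
    have : j ≤ r - 1 := Nat.find_min' hex (by
      rwa [Nat.sub_add_cancel hr0', Nat.mul_div_cancel_left _ hr0'])
    omega
  have h2 : j * p.1 / r ≤ i := by
    rcases Nat.eq_zero_or_pos j with h0 | h0
    · simp [h0]
    · have := Nat.find_min hex (m := j - 1) (by omega)
      rw [Nat.sub_add_cancel h0] at this
      omega
  have h3 := hp j (Finset.mem_range.2 hjr)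
  rw [← sub_div, div_lt_iff₀ hn] at h3
  have h4 := hmono p.2 h2
  have h5 := hmono p.2 (Nat.succ_le_of_lt h1)
  simp only [Nat.succ_eq_add_one] at h5 h4
  linarith

end Increments

/-! ### Deterministic analysis of the weighted lasso -/

section Lasso

variable {ι ρ : Type*} [Fintype ι] [Fintype ρ]

/-- The lasso objective with penalty weights `w q ∈ [0, ∞]`. -/
noncomputable def lassoObjective (D : Matrix ρ ι ℝ) (y : ρ → ℝ) (w : ι → ℝ≥0∞) (lam : ℝ)
    (Δ : ι → ℝ) : ℝ≥0∞ :=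
  ENNReal.ofReal (1 / 2 * ∑ r, (y r - D.mulVec Δ r) ^ 2) +
    ENNReal.ofReal lam * ∑ q, w q * ENNReal.ofReal |Δ q|

variable {D : Matrix ρ ι ℝ} {y : ρ → ℝ} {w : ι → ℝ≥0∞} {lam : ℝ} {Δ : ι → ℝ}

lemma lassoObjective_eq_ofReal (hlam : 0 ≤ lam) (h : ∀ q, Δ q ≠ 0 → w q ≠ ⊤) :
    lassoObjective D y w lam Δ = ENNReal.ofReal
      (1 / 2 * ∑ r, (y r - D.mulVec Δ r) ^ 2 + lam * ∑ q, (w q).toReal * |Δ q|) := by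
  have h1 : ∀ q, w q * ENNReal.ofReal |Δ q| = ENNReal.ofReal ((w q).toReal * |Δ q|) := by
    intro q
    by_cases hq : Δ q = 0
    · simp [hq]
    · rw [ENNReal.ofReal_mul ENNReal.toReal_nonneg, ENNReal.ofReal_toReal (h q hq)]
  have h2 : ∀ q, 0 ≤ (w q).toReal * |Δ q| := fun q =>
    mul_nonneg ENNReal.toReal_nonneg (abs_nonneg _)
  rw [lassoObjective, Finset.sum_congr rfl fun q _ => h1 q,
    ← ENNReal.ofReal_sum_of_nonneg fun q _ => h2 q, ← ENNReal.ofReal_mul hlam,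
    ← ENNReal.ofReal_add]
  · positivity
  · exact mul_nonneg hlam (Finset.sum_nonneg fun q _ => h2 q)

/-- A minimizer vanishes where the weight is infinite, provided some vector has a finite objective. -/
lemma weight_ne_top_of_isMinOn (hlam : 0 < lam)
    (hmin : IsMinOn (lassoObjective D y w lam) Set.univ Δ) {Δ' : ι → ℝ}
    (hΔ' : ∀ q, Δ' q ≠ 0 → w q ≠ ⊤) {q : ι} (hq : Δ q ≠ 0) : w q ≠ ⊤ := by
  intro htop
  have h1 : lassoObjective D y w lam Δ ≤ lassoObjective D y w lam Δ' := hmin (Set.mem_univ Δ')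
  rw [lassoObjective_eq_ofReal hlam.le hΔ'] at h1
  have h2 : lassoObjective D y w lam Δ = ⊤ := by
    rw [lassoObjective, ENNReal.add_eq_top]
    refine Or.inr (ENNReal.mul_eq_top.2 (Or.inl ⟨?_, ?_⟩))
    · simpa using hlam
    · refine ENNReal.sum_eq_top.2 ⟨q, Finset.mem_univ q, ?_⟩
      rw [htop, ENNReal.top_mul]
      simpa using hq
  rw [h2, top_le_iff] at h1
  exact ENNReal.ofReal_ne_top h1

lemma lasso_le_of_isMinOn (hlam : 0 < lam)
    (hmin : IsMinOn (lassoObjective D y w lam) Set.univ Δ) {Δ' : ι → ℝ}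
    (hΔ' : ∀ q, Δ' q ≠ 0 → w q ≠ ⊤) :
    1 / 2 * ∑ r, (y r - D.mulVec Δ r) ^ 2 + lam * ∑ q, (w q).toReal * |Δ q| ≤
      1 / 2 * ∑ r, (y r - D.mulVec Δ' r) ^ 2 + lam * ∑ q, (w q).toReal * |Δ' q| := by
  have h1 : lassoObjective D y w lam Δ ≤ lassoObjective D y w lam Δ' := hmin (Set.mem_univ Δ')
  rw [lassoObjective_eq_ofReal hlam.le hΔ', lassoObjective_eq_ofReal hlam.le
    fun q hq => weight_ne_top_of_isMinOn hlam hmin hΔ' hq] at h1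
  rwa [ENNReal.ofReal_le_ofReal_iff] at h1
  have h2 : 0 ≤ ∑ q, (w q).toReal * |Δ' q| := Finset.sum_nonneg fun q _ =>
    mul_nonneg ENNReal.toReal_nonneg (abs_nonneg _)
  positivity

lemma le_of_forall_mul_le {a b c : ℝ} (h : ∀ s : ℝ, 0 < s → s < 1 → s * a ≤ s * b + s ^ 2 * c) :
    a ≤ b := by
  have h1 : ∀ᶠ s : ℝ in 𝓝[>] 0, a ≤ b + s * c := by
    filter_upwards [Ioo_mem_nhdsGT (show (0 : ℝ) < 1 by norm_num)] with s hs
    have := h s hs.1 hs.2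
    refine le_of_mul_le_mul_left ?_ hs.1
    linarith
  have h2 : Tendsto (fun s : ℝ => b + s * c) (𝓝[>] 0) (𝓝 b) := by
    have : Continuous fun s : ℝ => b + s * c := by fun_prop
    simpa using (this.tendsto 0).mono_left nhdsWithin_le_nhds
  exact ge_of_tendsto h2 h1

lemma sum_sq_sub_mulVec (e v : ρ → ℝ) : ∑ r, (e r - v r) ^ 2 = e ⬝ᵥ e - 2 * e ⬝ᵥ v + v ⬝ᵥ v := by
  simp only [dotProduct, Finset.mul_sum, ← Finset.sum_sub_distrib, ← Finset.sum_add_distrib]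
  exact Finset.sum_congr rfl fun r _ => by ring

/-- Moving a minimizer by `h` in one coordinate does not decrease the objective. -/
lemma lasso_perturb [DecidableEq ι] (hlam : 0 < lam)
    (hmin : IsMinOn (lassoObjective D y w lam) Set.univ Δ) (hΔ : ∀ q, Δ q ≠ 0 → w q ≠ ⊤) {q : ι}
    (hq : w q ≠ ⊤) (h : ℝ) :
    lam * (w q).toReal * (|Δ q| - |Δ q + h|) ≤
      -h * (D.transpose.mulVec (y - D.mulVec Δ)) q + h ^ 2 * (1 / 2 * ∑ r, D r q ^ 2) := by
  have h1 := lasso_le_of_isMinOn hlam hmin (Δ' := Δ + Pi.single q h) (by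
    intro q' hq'
    by_cases hqq : q' = q
    · rwa [hqq]
    · exact hΔ q' (by simpa [hqq] using hq'))
  have h2 : ∑ q', (w q').toReal * |(Δ + Pi.single q h : ι → ℝ) q'| =
      ∑ q', (w q').toReal * |Δ q'| + (w q).toReal * (|Δ q + h| - |Δ q|) := by
    rw [← sub_eq_iff_eq_add', ← Finset.sum_sub_distrib]
    rw [Finset.sum_eq_single q]
    · simp; ring
    · intro b _ hb; simp [hb]
    · simp
  have h3 : ∑ r, (y r - D.mulVec (Δ + Pi.single q h) r) ^ 2 =
      ∑ r, (y r - D.mulVec Δ r) ^ 2 - 2 * (h * (D.transpose.mulVec (y - D.mulVec Δ)) q) +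
        h ^ 2 * ∑ r, D r q ^ 2 := by
    have h4 : ∀ r, D.mulVec (Δ + Pi.single q h) r = D.mulVec Δ r + h * D r q := by
      intro r
      rw [Matrix.mulVec_add, Pi.add_apply, Matrix.mulVec_single]
      simp [mul_comm]
    simp only [h4]
    have h5 : (D.transpose.mulVec (y - D.mulVec Δ)) q = ∑ r, D r q * (y r - D.mulVec Δ r) := rfl
    simp only [h5, Finset.mul_sum, ← Finset.sum_sub_distrib, ← Finset.sum_add_distrib]
    exact Finset.sum_congr rfl fun r _ => by ring
  rw [h2, h3] at h1
  linarith

/-- Stationarity: the correlation of a column of the design with the residual is at most the penalty. -/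
lemma abs_residual_le (hlam : 0 < lam) (hmin : IsMinOn (lassoObjective D y w lam) Set.univ Δ)
    (hΔ : ∀ q, Δ q ≠ 0 → w q ≠ ⊤) {q : ι} (hq : w q ≠ ⊤) :
    |(D.transpose.mulVec (y - D.mulVec Δ)) q| ≤ lam * (w q).toReal := by
  classical
  have hw : 0 ≤ lam * (w q).toReal := mul_nonneg hlam.le ENNReal.toReal_nonneg
  rw [abs_le']
  constructor
  all_goals
    refine le_of_forall_mul_le (c := 1 / 2 * ∑ r, D r q ^ 2) fun s hs _ => ?_
  · have h1 := lasso_perturb hlam hmin hΔ hq s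
    have h2 : |Δ q + s| ≤ |Δ q| + s := (abs_add_le _ _).trans_eq (by rw [abs_of_pos hs])
    nlinarith
  · have h1 := lasso_perturb hlam hmin hΔ hq (-s)
    have h2 : |Δ q + -s| ≤ |Δ q| + s := (abs_add_le _ _).trans_eq (by rw [abs_neg, abs_of_pos hs])
    nlinarith

/-- Stationarity at a non-zero coordinate, in the direction opposite to `abs_residual_le`. -/
lemma weight_le_abs_residual (hlam : 0 < lam)
    (hmin : IsMinOn (lassoObjective D y w lam) Set.univ Δ) (hΔ : ∀ q, Δ q ≠ 0 → w q ≠ ⊤) {q : ι}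
    (hq : Δ q ≠ 0) :
    lam * (w q).toReal ≤ |(D.transpose.mulVec (y - D.mulVec Δ)) q| := by
  classical
  have h0 : 0 < |Δ q| := abs_pos.2 hq
  refine le_of_mul_le_mul_right (a := |Δ q|) ?_ h0
  refine (le_of_forall_mul_le (b := Δ q * (D.transpose.mulVec (y - D.mulVec Δ)) q)
    (c := Δ q ^ 2 * (1 / 2 * ∑ r, D r q ^ 2)) fun s hs hs1 => ?_).trans ?_
  · have h1 := lasso_perturb hlam hmin hΔ (hΔ q hq) (-(s * Δ q))
    have h2 : |Δ q + -(s * Δ q)| = (1 - s) * |Δ q| := by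
      rw [show Δ q + -(s * Δ q) = (1 - s) * Δ q by ring, abs_mul, abs_of_pos (sub_pos.2 hs1)]
    rw [h2] at h1
    linarith
  · rw [mul_comm]
    refine (le_abs_self _).trans_eq (abs_mul _ _)

lemma dotProduct_le_card_mul (u v : ι → ℝ) : u ⬝ᵥ v ≤ Fintype.card ι * (‖u‖ * ‖v‖) := by
  calc u ⬝ᵥ v ≤ ∑ _q : ι, ‖u‖ * ‖v‖ := by
        refine Finset.sum_le_sum fun q _ => (le_abs_self _).trans ?_
        rw [abs_mul]
        exact mul_le_mul (norm_le_pi_norm u q) (norm_le_pi_norm v q) (abs_nonneg _) (norm_nonneg _)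
    _ = _ := by simp

/-- The rate of a lasso minimizer. With response `y = D Δ₀ + e`, comparing the objective at the
minimizer and at `Δ₀` bounds the quadratic form of the error by linear terms. -/
lemma lasso_error_le (hlam : 0 < lam) (hmin : IsMinOn (lassoObjective D y w lam) Set.univ Δ)
    {Δ₀ : ι → ℝ} {e : ρ → ℝ} (hy : y = D.mulVec Δ₀ + e) {c W : ℝ} (hW : 0 ≤ W)
    (hw : ∀ q, Δ₀ q ≠ 0 → w q ≠ ⊤ ∧ (w q).toReal ≤ W)
    (hD : ∀ v : ι → ℝ, c * ‖v‖ ^ 2 ≤ D.mulVec v ⬝ᵥ D.mulVec v) :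
    c * ‖Δ - Δ₀‖ ≤ 2 * Fintype.card ι * (‖D.transpose.mulVec e‖ + lam * W) := by
  have h1 := lasso_le_of_isMinOn hlam hmin (Δ' := Δ₀) fun q hq => (hw q hq).1
  have h2 : ∀ Δ' : ι → ℝ, ∀ r, y r - D.mulVec Δ' r = e r - D.mulVec (Δ' - Δ₀) r := by
    intro Δ' r
    rw [hy, Matrix.mulVec_sub]
    simp only [Pi.add_apply, Pi.sub_apply]
    ring
  simp only [h2, sum_sq_sub_mulVec] at h1
  have h3 : e ⬝ᵥ D.mulVec (Δ - Δ₀) = D.transpose.mulVec e ⬝ᵥ (Δ - Δ₀) := by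
    rw [Matrix.dotProduct_mulVec, Matrix.mulVec_transpose]
  have h4 := dotProduct_le_card_mul (D.transpose.mulVec e) (Δ - Δ₀)
  have h5 : ∑ q, (w q).toReal * |Δ₀ q| - ∑ q, (w q).toReal * |Δ q| ≤
      Fintype.card ι * (W * ‖Δ - Δ₀‖) := by
    rw [← Finset.sum_sub_distrib]
    calc _ ≤ ∑ _q : ι, W * ‖Δ - Δ₀‖ := by
          refine Finset.sum_le_sum fun q _ => ?_
          have hv : |Δ₀ q| - |Δ q| ≤ ‖Δ - Δ₀‖ := by
            refine (abs_sub_abs_le_abs_sub _ _).trans ?_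
            rw [abs_sub_comm]
            exact norm_le_pi_norm (Δ - Δ₀) q
          by_cases hq : Δ₀ q = 0
          · rw [hq, abs_zero, mul_zero, zero_sub]
            have h6 : 0 ≤ (w q).toReal * |Δ q| := mul_nonneg ENNReal.toReal_nonneg (abs_nonneg _)
            have h7 : 0 ≤ W * ‖Δ - Δ₀‖ := mul_nonneg hW (norm_nonneg _)
            linarith
          · rw [← mul_sub]
            exact (mul_le_mul_of_nonneg_left hv ENNReal.toReal_nonneg).trans
              (mul_le_mul_of_nonneg_right (hw q hq).2 (norm_nonneg _))
      _ = _ := by simp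
  have h6 := hD (Δ - Δ₀)
  simp only [sub_self, Matrix.mulVec_zero, dotProduct_zero, mul_zero, sub_zero, add_zero] at h1
  rw [h3] at h1
  have h7 := mul_le_mul_of_nonneg_left h5 hlam.le
  rcases (norm_nonneg (Δ - Δ₀)).eq_or_lt with h8 | h8
  · rw [← h8, mul_zero]
    have := norm_nonneg (D.transpose.mulVec e)
    positivity
  · refine le_of_mul_le_mul_right ?_ h8
    nlinarith

end Lasso

/-! ### Minimum spanning trees -/

section Trees

variable {m d : ℕ} {t t' : Fin m → Fin (m + 1) × Fin (m + 1)}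

/-- The graph formed by the edges `t l` with `l ∈ S`. -/
def edgeGraph (t : Fin m → Fin (m + 1) × Fin (m + 1)) (S : Set (Fin m)) :
    SimpleGraph (Fin (m + 1)) :=
  SimpleGraph.fromEdgeSet ((fun l => s((t l).1, (t l).2)) '' S)

lemma edgeGraph_adj (hlt : ∀ l, (t l).1 < (t l).2) {S : Set (Fin m)} {i j : Fin (m + 1)} :
    (edgeGraph t S).Adj i j ↔ ∃ l ∈ S, s((t l).1, (t l).2) = s(i, j) := by
  rw [edgeGraph, SimpleGraph.fromEdgeSet_adj]
  refine ⟨fun h => h.1, fun ⟨l, hl, h⟩ => ⟨⟨l, hl, h⟩, ?_⟩⟩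
  rintro rfl
  have h1 := (hlt l).ne
  simp only [Sym2.eq_iff, or_self] at h
  exact h1 (h.1.trans h.2.symm)

lemma IsSpanningTree.isTree_edgeGraph (h : IsSpanningTree t) : (edgeGraph t Set.univ).IsTree := by
  rw [edgeGraph, Set.image_univ]
  exact h.isTree

lemma sym2_injective (hlt : ∀ l, (t l).1 < (t l).2) (hinj : Function.Injective t) :
    Function.Injective fun l => s((t l).1, (t l).2) := by
  intro l l' h
  simp only [Sym2.eq_iff] at h
  rcases h with h | h
  · exact hinj (Prod.ext h.1 h.2)
  · have h1 := hlt l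
    have h2 := hlt l'
    rw [h.1, h.2] at h1
    exact absurd h1 h2.asymm

lemma edgeSet_edgeGraph (hlt : ∀ l, (t l).1 < (t l).2) :
    (edgeGraph t Set.univ).edgeSet = Set.range fun l => s((t l).1, (t l).2) := by
  ext e
  induction e using Sym2.ind with
  | _ i j =>
    rw [SimpleGraph.mem_edgeSet, edgeGraph_adj hlt]
    simp

lemma isSpanningTree_of_connected (hlt : ∀ l, (t l).1 < (t l).2) (hinj : Function.Injective t)
    (hconn : (edgeGraph t Set.univ).Connected) : IsSpanningTree t := by
  refine ⟨hlt, hinj, ?_⟩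
  rw [← Set.image_univ]
  refine SimpleGraph.isTree_iff_connected_and_card.2 ⟨hconn, ?_⟩
  change Nat.card (edgeGraph t Set.univ).edgeSet + 1 = _
  rw [edgeSet_edgeGraph hlt, Nat.card_range_of_injective (sym2_injective hlt hinj)]
  simp

/-- The exchange property of minimum spanning trees: the end points of any potential edge are joined in
the tree by edges that are not heavier than it. -/
lemma IsMinSpanningTree.reachable {w : Fin (m + 1) × Fin (m + 1) → ℝ≥0∞}
    (h : IsMinSpanningTree w t) (hfin : ∀ l, w (t l) ≠ ⊤) {i j : Fin (m + 1)} (hij : i < j) :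
    (edgeGraph t {l | w (t l) ≤ w (i, j)}).Reachable i j := by
  classical
  have hlt := h.1.lt
  have hT := h.1.isTree_edgeGraph
  set T := edgeGraph t Set.univ with hTdef
  by_cases hadj : T.Adj i j
  · obtain ⟨l, -, hl⟩ := (edgeGraph_adj hlt).1 hadj
    refine SimpleGraph.Adj.reachable ((edgeGraph_adj hlt).2 ⟨l, ?_, hl⟩)
    have h1 : t l = (i, j) := by
      rcases Sym2.eq_iff.1 hl with h2 | h2
      · exact Prod.ext h2.1 h2.2
      · have := hlt l
        rw [h2.1, h2.2] at this
        exact absurd this hij.asymm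
    simp [h1]
  obtain ⟨p, hp⟩ := hT.connected.exists_isPath j i
  by_contra hnot
  have hheavy : ∃ l, s((t l).1, (t l).2) ∈ p.edges ∧ w (i, j) < w (t l) := by
    by_contra hcon
    push Not at hcon
    refine hnot (SimpleGraph.Walk.reachable (p.transfer _ fun e he => ?_)).symm
    have h1 := p.edges_subset_edgeSet he
    rw [edgeSet_edgeGraph hlt] at h1
    obtain ⟨l, rfl⟩ := h1
    rw [SimpleGraph.mem_edgeSet, edgeGraph_adj hlt]
    exact ⟨l, hcon l he, rfl⟩
  obtain ⟨l, hl, hwl⟩ := hheavy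
  -- adding `ij` to the tree closes a cycle through the heavy edge, which can then be removed
  set T' := T ⊔ SimpleGraph.edge i j with hT'
  have hT'conn : T'.Connected := hT.connected.mono le_sup_left
  have hadj' : T'.Adj i j := by
    rw [hT', SimpleGraph.sup_adj, SimpleGraph.edge_adj]
    exact Or.inr ⟨Or.inl ⟨rfl, rfl⟩, hij.ne⟩
  have hcyc : (SimpleGraph.Walk.cons hadj' (p.mapLe le_sup_left)).IsCycle := by
    rw [SimpleGraph.Walk.cons_isCycle_iff]
    refine ⟨(SimpleGraph.Walk.isPath_mapLe _).2 hp, fun hmem => hadj ?_⟩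
    rw [SimpleGraph.Walk.edges_mapLe_eq_edges] at hmem
    exact p.adj_of_mem_edges hmem
  have hnb : ¬ T'.IsBridge s((t l).1, (t l).2) := fun hb =>
    hb.notMem_edges_of_isCycle hcyc (by
      rw [SimpleGraph.Walk.edges_cons, SimpleGraph.Walk.edges_mapLe_eq_edges]
      exact List.mem_cons_of_mem _ hl)
  have hconn := hT'conn.connected_delete_edge_of_not_isBridge hnb
  set t₁ := Function.update t l (i, j) with ht₁
  have hlt₁ : ∀ l', (t₁ l').1 < (t₁ l').2 := by
    intro l'
    by_cases hl' : l' = l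
    · subst hl'; simpa [ht₁] using hij
    · simpa [ht₁, hl'] using hlt l'
  have hnotmem : ∀ l', t l' ≠ (i, j) := fun l' h1 =>
    hadj ((edgeGraph_adj hlt).2 ⟨l', trivial, by rw [h1]⟩)
  have hinj₁ : Function.Injective t₁ := by
    intro a b hab
    by_cases ha : a = l <;> by_cases hb : b = l
    · rw [ha, hb]
    · subst ha
      simp only [ht₁, Function.update_self, Function.update_of_ne hb] at hab
      exact absurd hab.symm (hnotmem b)
    · subst hb
      simp only [ht₁, Function.update_self, Function.update_of_ne ha] at hab
      exact absurd hab (hnotmem a)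
    · simp only [ht₁, Function.update_of_ne ha, Function.update_of_ne hb] at hab
      exact h.1.injective hab
  have htree₁ : IsSpanningTree t₁ := by
    refine isSpanningTree_of_connected hlt₁ hinj₁ (hconn.mono ?_)
    intro a b hab
    rw [SimpleGraph.deleteEdges_adj, hT', SimpleGraph.sup_adj, SimpleGraph.edge_adj] at hab
    rw [edgeGraph_adj hlt₁]
    rcases hab.1 with h1 | h1
    · obtain ⟨l', -, hl'⟩ := (edgeGraph_adj hlt).1 h1
      have hne : l' ≠ l := by
        rintro rfl
        exact hab.2 (by rw [hl']; rfl)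
      exact ⟨l', trivial, by simpa [ht₁, hne] using hl'⟩
    · refine ⟨l, trivial, ?_⟩
      simp only [ht₁, Function.update_self]
      rcases h1.1 with h2 | h2
      · rw [h2.1, h2.2]
      · rw [h2.1, h2.2, Sym2.eq_swap]
  have hle := h.2 t₁ htree₁
  rw [← Finset.add_sum_erase _ _ (Finset.mem_univ l),
    ← Finset.add_sum_erase _ (fun l => w (t₁ l)) (Finset.mem_univ l)] at hle
  have h2 : ∑ l' ∈ Finset.univ.erase l, w (t₁ l') = ∑ l' ∈ Finset.univ.erase l, w (t l') :=
    Finset.sum_congr rfl fun l' hl' => by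
      simp [ht₁, Function.update_of_ne (Finset.ne_of_mem_erase hl')]
  rw [h2] at hle
  have h3 : ∑ l' ∈ Finset.univ.erase l, w (t l') ≠ ⊤ := by
    rw [ENNReal.sum_ne_top]
    exact fun l' _ => hfin l'
  have h4 := (ENNReal.add_le_add_iff_right h3).1 hle
  simp only [ht₁, Function.update_self] at h4
  exact absurd h4 (not_le.2 hwl)

lemma exists_isSpanningTree_adj {G : SimpleGraph (Fin (m + 1))} (hG : G.Connected) :
    ∃ t, IsSpanningTree (m := m) t ∧ ∀ l, G.Adj (t l).1 (t l).2 := by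
  obtain ⟨T, hTG, hT⟩ := hG.exists_isTree_le
  have hcard := (SimpleGraph.isTree_iff_connected_and_card.1 hT).2
  rw [Nat.card_eq_fintype_card (α := Fin (m + 1)), Fintype.card_fin, add_left_inj] at hcard
  let f : Fin m ≃ T.edgeSet := (Finite.equivFinOfCardEq hcard).symm
  have hmk : ∀ e : Sym2 (Fin (m + 1)), s(e.inf, e.sup) = e := fun e => Sym2.sortEquiv.left_inv e
  let t : Fin m → Fin (m + 1) × Fin (m + 1) := fun l => ((f l : Sym2 _).inf, (f l : Sym2 _).sup)
  have hsym : ∀ l, s((t l).1, (t l).2) = f l := fun l => hmk _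
  have hadj : ∀ l, T.Adj (t l).1 (t l).2 := by
    intro l
    rw [← SimpleGraph.mem_edgeSet, hsym]
    exact (f l).2
  have hlt : ∀ l, (t l).1 < (t l).2 := fun l =>
    lt_of_le_of_ne (Sym2.inf_le_sup _) (hadj l).ne
  have hinj : Function.Injective t := by
    intro a b hab
    refine f.injective (Subtype.ext ?_)
    rw [← hsym, ← hsym, hab]
  refine ⟨t, isSpanningTree_of_connected hlt hinj (hT.connected.mono ?_), fun l => hTG (hadj l)⟩
  intro a b hab
  rw [edgeGraph_adj hlt]
  refine ⟨f.symm ⟨s(a, b), hab⟩, trivial, ?_⟩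
  rw [hsym, Equiv.apply_symm_apply]

/-- In a spanning tree of minimal total similarity all edges belong to the connected network. -/
lemma IsMinSpanningTree.adj {G : SimpleGraph (Fin (m + 1))} (hG : G.Connected)
    {x : Fin (m + 1) → ℕ → Fin d → ℝ} {y : Fin (m + 1) → ℕ → ℝ} {n : ℕ}
    (h : IsMinSpanningTree (similarity G x y n) t) (l : Fin m) : G.Adj (t l).1 (t l).2 := by
  obtain ⟨t₁, ht₁, hadj⟩ := exists_isSpanningTree_adj hG
  by_contra hcon
  have h1 : ∑ l, similarity G x y n (t l) = ⊤ :=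
    ENNReal.sum_eq_top.2 ⟨l, Finset.mem_univ l, by simp [similarity, hcon]⟩
  have h2 : ∑ l, similarity G x y n (t₁ l) ≠ ⊤ := by
    rw [ENNReal.sum_ne_top]
    intro l _
    simp [similarity, hadj l]
  exact h2 (top_le_iff.1 (h1 ▸ h.2 t₁ ht₁))

/-- The spanning tree `t` uses edges of the network only, and any two adjacent nodes of the same
cluster are joined in it by a path inside that cluster. -/
structure IsClusterTree (G : SimpleGraph (Fin (m + 1))) (β : Fin (m + 1) → Fin d → ℝ)
    (t : Fin m → Fin (m + 1) × Fin (m + 1)) : Prop where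
  isSpanningTree : IsSpanningTree t
  adj : ∀ l, G.Adj (t l).1 (t l).2
  reachable : ∀ i j, G.Adj i j → β i = β j →
    (edgeGraph t {l | β (t l).1 = β (t l).2}).Reachable i j

lemma similarity_of_adj {G : SimpleGraph (Fin (m + 1))} {x : Fin (m + 1) → ℕ → Fin d → ℝ}
    {y : Fin (m + 1) → ℕ → ℝ} {n : ℕ} {i j : Fin (m + 1)} (h : G.Adj i j) :
    similarity G x y n (i, j) =
      ENNReal.ofReal ‖WithLp.toLp 2 (ols x y n i) - WithLp.toLp 2 (ols x y n j)‖ := by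
  simp [similarity, h]

/-- If the local estimators within clusters are closer to one another than those in different clusters,
then the minimum spanning tree prefers the edges inside clusters. -/
lemma IsMinSpanningTree.isClusterTree {G : SimpleGraph (Fin (m + 1))} (hG : G.Connected)
    {x : Fin (m + 1) → ℕ → Fin d → ℝ} {y : Fin (m + 1) → ℕ → ℝ} {n : ℕ}
    (h : IsMinSpanningTree (similarity G x y n) t) {β : Fin (m + 1) → Fin d → ℝ} {r : ℝ}
    (hintra : ∀ i j, β i = β j →
      ‖WithLp.toLp 2 (ols x y n i) - WithLp.toLp 2 (ols x y n j)‖ < r)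
    (hinter : ∀ i j, β i ≠ β j →
      r ≤ ‖WithLp.toLp 2 (ols x y n i) - WithLp.toLp 2 (ols x y n j)‖) :
    IsClusterTree G β t := by
  have hadj := h.adj hG
  have hfin : ∀ l, similarity G x y n (t l) ≠ ⊤ := fun l => by
    rw [← Prod.mk.eta (p := t l), similarity_of_adj (hadj l)]
    exact ENNReal.ofReal_ne_top
  have key : ∀ i j, i < j → G.Adj i j → β i = β j →
      (edgeGraph t {l | β (t l).1 = β (t l).2}).Reachable i j := by
    intro i j hij hGij hβ
    refine (h.reachable hfin hij).mono (SimpleGraph.fromEdgeSet_mono (Set.image_mono ?_))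
    intro l hl
    by_contra hcon
    have h1 : similarity G x y n (t l) ≤ similarity G x y n (i, j) := hl
    rw [← Prod.mk.eta (p := t l), similarity_of_adj (hadj l), similarity_of_adj hGij,
      ENNReal.ofReal_le_ofReal_iff (norm_nonneg _)] at h1
    exact absurd ((hinter _ _ hcon).trans h1) (not_le.2 (hintra i j hβ))
  refine ⟨h.1, hadj, fun i j hGij hβ => ?_⟩
  rcases lt_trichotomy i j with hij | hij | hij
  · exact key i j hij hGij hβ
  · rw [hij]
  · exact (key j i hij hGij.symm hβ.symm).symm

end Trees

/-! ### The incidence matrix of a spanning tree -/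

section Incidence

variable {m d : ℕ} {t t' : Fin m → Fin (m + 1) × Fin (m + 1)}

lemma eq_of_reachable {V : Type*} {H : SimpleGraph V} {b : V → ℝ}
    (h : ∀ i j, H.Adj i j → b i = b j) {i j : V} (hij : H.Reachable i j) : b i = b j := by
  obtain ⟨p⟩ := hij
  induction p with
  | nil => rfl
  | cons hadj _ ih => exact (h _ _ hadj).trans ih

lemma eq_of_edgeGraph_reachable (hlt : ∀ l, (t l).1 < (t l).2) {S : Set (Fin m)}
    {b : Fin (m + 1) → ℝ} (h : ∀ l ∈ S, b (t l).1 = b (t l).2) {i j : Fin (m + 1)}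
    (hij : (edgeGraph t S).Reachable i j) : b i = b j := by
  refine eq_of_reachable (fun a c hac => ?_) hij
  obtain ⟨l, hl, hs⟩ := (edgeGraph_adj hlt).1 hac
  rcases Sym2.eq_iff.1 hs with h1 | h1
  · rw [← h1.1, ← h1.2, h l hl]
  · rw [← h1.1, ← h1.2, h l hl]

lemma augIncidence_mulVec_castSucc (hlt : ∀ l, (t l).1 < (t l).2) (b : Fin (m + 1) → ℝ)
    (l : Fin m) : (augIncidence t).mulVec b l.castSucc = b (t l).1 - b (t l).2 := by
  have h1 : ∀ i, augIncidence t l.castSucc i * b i =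
      (if i = (t l).1 then b i else 0) - (if i = (t l).2 then b i else 0) := by
    intro i
    simp only [augIncidence, Matrix.of_apply, Fin.lastCases_castSucc]
    by_cases h2 : i = (t l).1
    · have h3 : i ≠ (t l).2 := h2 ▸ (hlt l).ne
      simp [h2, (hlt l).ne]
    · by_cases h3 : i = (t l).2
      · simp [h3, (hlt l).ne']
      · simp [h2, h3]
  simp [Matrix.mulVec, dotProduct, h1, Finset.sum_sub_distrib]

lemma augIncidence_mulVec_last (b : Fin (m + 1) → ℝ) :
    (augIncidence t).mulVec b (Fin.last m) = 1 / √((m : ℝ) + 1) * ∑ i, b i := by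
  simp [Matrix.mulVec, dotProduct, augIncidence, Finset.mul_sum]

lemma IsSpanningTree.isUnit_det (h : IsSpanningTree t) : IsUnit (augIncidence t).det := by
  rw [isUnit_iff_ne_zero, Ne, ← Matrix.exists_mulVec_eq_zero_iff]
  rintro ⟨b, hb0, hb⟩
  have h1 : ∀ l, b (t l).1 = b (t l).2 := fun l => by
    have := congrFun hb l.castSucc
    rw [augIncidence_mulVec_castSucc h.lt] at this
    exact sub_eq_zero.1 this
  have h2 : ∀ i, b i = b 0 := fun i =>
    eq_of_edgeGraph_reachable h.lt (fun l _ => h1 l) (h.isTree_edgeGraph.connected i 0)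
  have h3 := congrFun hb (Fin.last m)
  rw [augIncidence_mulVec_last, Finset.sum_congr rfl fun i _ => h2 i] at h3
  simp only [Finset.sum_const, Finset.card_univ, Fintype.card_fin, nsmul_eq_mul, Pi.zero_apply,
    mul_eq_zero, one_div, inv_eq_zero, Nat.cast_add, Nat.cast_one] at h3
  have h4 : (0 : ℝ) < (m : ℝ) + 1 := by positivity
  have h5 : √((m : ℝ) + 1) ≠ 0 := (Real.sqrt_pos.2 h4).ne'
  refine hb0 (funext fun i => ?_)
  rw [h2 i]
  exact (h3.resolve_left h5).resolve_left h4.ne'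

lemma IsSpanningTree.isUnit_det_diffMatrix (h : IsSpanningTree t) :
    IsUnit (diffMatrix d t).det := by
  rw [diffMatrix, Matrix.det_kronecker, Matrix.det_one, one_pow, mul_one]
  exact h.isUnit_det.pow _

lemma diffMatrix_mulVec_apply (v : Fin (m + 1) × Fin d → ℝ) (q : Fin (m + 1) × Fin d) :
    (diffMatrix d t).mulVec v q = (augIncidence t).mulVec (fun i => v (i, q.2)) q.1 := by
  obtain ⟨l, p⟩ := q
  simp only [Matrix.mulVec, dotProduct, diffMatrix, Matrix.kroneckerMap_apply,
    Fintype.sum_prod_type]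
  refine Finset.sum_congr rfl fun i _ => ?_
  rw [Finset.sum_eq_single p]
  · simp
  · intro b _ hb; simp [Matrix.one_apply_ne hb.symm]
  · simp

lemma differences_apply (b : Fin (m + 1) → Fin d → ℝ) (q : Fin (m + 1) × Fin d) :
    differences t b q = (augIncidence t).mulVec (fun i => b i q.2) q.1 :=
  diffMatrix_mulVec_apply _ q

lemma SameInterCluster.symm_trans {β : Fin (m + 1) → Fin d → ℝ}
    {t t' t₀ : Fin m → Fin (m + 1) × Fin (m + 1)}
    (h : SameInterCluster β t t₀) (h' : SameInterCluster β t' t₀) : SameInterCluster β t t' := by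
  intro l hl
  rcases hl with hl | hl
  · have h1 := h l (Or.inl hl)
    rw [h1] at hl
    rw [h1, h' l (Or.inr hl)]
  · have h1 := h' l (Or.inl hl)
    rw [h1] at hl
    rw [h1, h l (Or.inr hl)]

/-- Trees with the same inter-cluster edges have the same true differences. -/
lemma SameInterCluster.differences_eq {β : Fin (m + 1) → Fin d → ℝ} (hlt : ∀ l, (t l).1 < (t l).2)
    (hlt' : ∀ l, (t' l).1 < (t' l).2) (h : SameInterCluster β t t') :
    differences t β = differences t' β := by
  ext ⟨l, p⟩
  rw [differences_apply, differences_apply]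
  refine Fin.lastCases ?_ (fun l => ?_) l
  · rw [augIncidence_mulVec_last, augIncidence_mulVec_last]
  · rw [augIncidence_mulVec_castSucc hlt, augIncidence_mulVec_castSucc hlt']
    by_cases h1 : β (t l).1 ≠ β (t l).2 ∨ β (t' l).1 ≠ β (t' l).2
    · rw [h l h1]
    · push Not at h1
      simp [h1.1, h1.2]

/-- The columns of the inverse incidence matrix that correspond to inter-cluster edges or to the network
average depend on the tree only through its inter-cluster edges. Such a column is the function on the
nodes with a single jump, along the given edge; it is constant on the sets of nodes joined by
intra-cluster edges, and these are the same for all cluster trees. -/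
lemma inv_augIncidence_col_eq {G : SimpleGraph (Fin (m + 1))} {β : Fin (m + 1) → Fin d → ℝ}
    (h : IsClusterTree G β t) (h' : IsClusterTree G β t') (hs : SameInterCluster β t t')
    {l₀ : Fin (m + 1)} (hl₀ : ∀ l : Fin m, l.castSucc = l₀ → β (t l).1 ≠ β (t l).2)
    (k : Fin (m + 1)) : (augIncidence t)⁻¹ k l₀ = (augIncidence t')⁻¹ k l₀ := by
  have hlt := h.isSpanningTree.lt
  have hlt' := h'.isSpanningTree.lt
  set b : Fin (m + 1) → ℝ := fun k => (augIncidence t)⁻¹ k l₀ with hb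
  have hcol : ∀ (M N : Matrix (Fin (m + 1)) (Fin (m + 1)) ℝ), M.mulVec (fun k => N k l₀) =
      fun k => (M * N) k l₀ := fun M N => rfl
  have hone : (augIncidence t).mulVec b = fun k => (1 : Matrix _ _ ℝ) k l₀ := by
    rw [hb, hcol, Matrix.mul_nonsing_inv _ h.isSpanningTree.isUnit_det]
  have hdiff : ∀ l : Fin m, b (t l).1 - b (t l).2 = (1 : Matrix _ _ ℝ) l.castSucc l₀ := fun l => by
    rw [← augIncidence_mulVec_castSucc hlt, hone]
  have hintra : ∀ l : Fin m, β (t l).1 = β (t l).2 → b (t l).1 = b (t l).2 := by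
    intro l hl
    rw [← sub_eq_zero, hdiff]
    exact Matrix.one_apply_ne fun hcon => hl₀ l hcon hl
  have hone' : (augIncidence t').mulVec b = fun k => (1 : Matrix _ _ ℝ) k l₀ := by
    ext l
    refine Fin.lastCases ?_ (fun l => ?_) l
    · rw [← congrFun hone, augIncidence_mulVec_last, augIncidence_mulVec_last]
    · rw [augIncidence_mulVec_castSucc hlt', ← hdiff]
      by_cases h1 : β (t l).1 ≠ β (t l).2 ∨ β (t' l).1 ≠ β (t' l).2
      · rw [hs l h1]
      · push Not at h1
        rw [sub_eq_zero.2 (hintra l h1.1), sub_eq_zero]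
        exact eq_of_edgeGraph_reachable hlt hintra (h.reachable _ _ (h'.adj l) h1.2)
  have hfin : b = fun k => (augIncidence t')⁻¹ k l₀ := by
    have h1 := congrArg (augIncidence t')⁻¹.mulVec hone'
    rw [Matrix.mulVec_mulVec, Matrix.nonsing_inv_mul _ h'.isSpanningTree.isUnit_det,
      Matrix.one_mulVec, hcol, mul_one] at h1
    exact h1
  exact congrFun hfin k

lemma inv_diffMatrix_apply (q q' : Fin (m + 1) × Fin d) :
    (diffMatrix d t)⁻¹ q q' = (augIncidence t)⁻¹ q.1 q'.1 * (1 : Matrix _ _ ℝ) q.2 q'.2 := by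
  rw [diffMatrix, Matrix.inv_kronecker, inv_one, Matrix.kroneckerMap_apply]

end Incidence

/-! ### The design and the local estimators -/

section Design

variable {m d : ℕ}

/-- The normalized Gram matrix `XᵀX / N` of the untransformed block design. -/
noncomputable def covMatrix (x : Fin (m + 1) → ℕ → Fin d → ℝ) (n : ℕ) :
    Matrix (Fin (m + 1) × Fin d) (Fin (m + 1) × Fin d) ℝ :=
  (1 / totalSize m n) • ((blockDesign x n).transpose * blockDesign x n)

/-- The normalized score `Xᵀ e / √N` of the errors `e`. -/
noncomputable def score (x : Fin (m + 1) → ℕ → Fin d → ℝ) (e : Fin (m + 1) → ℕ → ℝ) (n : ℕ) :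
    Fin (m + 1) × Fin d → ℝ :=
  (√(totalSize m n))⁻¹ • (blockDesign x n).transpose.mulVec fun r => e r.1 r.2

/-- The weight of the error of observation `j = (k, i)` in the linear combination `θ ⬝ᵥ score`. -/
noncomputable def scoreWeight (θ : Fin (m + 1) × Fin d → ℝ) (n : ℕ) (j : Fin (m + 1) × ℕ)
    (x : Fin (m + 1) × ℕ → Fin d → ℝ) : ℝ :=
  (√(totalSize m n))⁻¹ * ∑ p, θ (j.1, p) * x j p

variable {x : Fin (m + 1) → ℕ → Fin d → ℝ} {n : ℕ} {t : Fin m → Fin (m + 1) × Fin (m + 1)}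

lemma totalSize_nonneg (m n : ℕ) : 0 ≤ totalSize m n := Nat.cast_nonneg _

lemma totalSize_eq (m n : ℕ) : totalSize m n = ((m : ℝ) + 1) * n := by simp [totalSize]

lemma tendsto_totalSize (m : ℕ) : Tendsto (totalSize m) atTop atTop := by
  have h : Tendsto (fun n : ℕ => ((m : ℝ) + 1) * n) atTop atTop :=
    tendsto_natCast_atTop_atTop.const_mul_atTop (by positivity)
  exact h.congr fun n => (totalSize_eq m n).symm

lemma tendsto_sqrt_totalSize (m : ℕ) : Tendsto (fun n => √(totalSize m n)) atTop atTop :=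
  Real.tendsto_sqrt_atTop.comp (tendsto_totalSize m)

lemma blockDesign_mulVec (v : Fin (m + 1) × Fin d → ℝ) (r : Fin (m + 1) × Fin n) :
    (blockDesign x n).mulVec v r = ∑ p, v (r.1, p) * x r.1 r.2 p := by
  simp only [Matrix.mulVec, dotProduct, blockDesign, Matrix.of_apply, nodeDesign,
    Fintype.sum_prod_type]
  rw [Finset.sum_eq_single r.1]
  · simp [mul_comm]
  · intro b _ hb; simp [hb.symm]
  · simp

lemma sum_prod_fin_eq (f : Fin (m + 1) × ℕ → ℝ) :
    ∑ r : Fin (m + 1) × Fin n, f (r.1, r.2) =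
      ∑ j ∈ (Finset.univ : Finset (Fin (m + 1))) ×ˢ Finset.range n, f j := by
  rw [Finset.sum_product, Fintype.sum_prod_type]
  exact Finset.sum_congr rfl fun k _ => Fin.sum_univ_eq_sum_range (fun i => f (k, i)) n

lemma dotProduct_score (e : Fin (m + 1) → ℕ → ℝ) (θ : Fin (m + 1) × Fin d → ℝ) :
    θ ⬝ᵥ score x e n = ∑ j ∈ (Finset.univ : Finset (Fin (m + 1))) ×ˢ Finset.range n,
      scoreWeight θ n j (fun j => x j.1 j.2) * e j.1 j.2 := by
  rw [score, dotProduct_smul, Matrix.mulVec_transpose, dotProduct_comm, ← Matrix.dotProduct_mulVec,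
    ← sum_prod_fin_eq, smul_eq_mul, dotProduct, Finset.mul_sum]
  refine Finset.sum_congr rfl fun r _ => ?_
  rw [blockDesign_mulVec, scoreWeight]
  ring

lemma dotProduct_covMatrix (θ : Fin (m + 1) × Fin d → ℝ) :
    θ ⬝ᵥ (covMatrix x n).mulVec θ =
      ∑ j ∈ (Finset.univ : Finset (Fin (m + 1))) ×ˢ Finset.range n,
        scoreWeight θ n j (fun j => x j.1 j.2) ^ 2 := by
  rw [covMatrix, Matrix.smul_mulVec, dotProduct_smul, ← Matrix.mulVec_mulVec,
    Matrix.dotProduct_mulVec, Matrix.vecMul_transpose, ← sum_prod_fin_eq, smul_eq_mul, dotProduct,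
    Finset.mul_sum]
  refine Finset.sum_congr rfl fun r _ => ?_
  rw [blockDesign_mulVec, scoreWeight, mul_pow, inv_pow, Real.sq_sqrt (totalSize_nonneg m n)]
  ring

lemma gram_eq : gram x n t =
    ((diffMatrix d t)⁻¹).transpose * covMatrix x n * (diffMatrix d t)⁻¹ := by
  simp only [gram, transDesign, covMatrix, Matrix.transpose_mul, Matrix.mul_smul, Matrix.smul_mul,
    Matrix.mul_assoc]

lemma dotProduct_gram (v : Fin (m + 1) × Fin d → ℝ) :
    v ⬝ᵥ (gram x n t).mulVec v =
      1 / totalSize m n * ((transDesign x n t).mulVec v ⬝ᵥ (transDesign x n t).mulVec v) := by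
  rw [gram, Matrix.smul_mulVec, dotProduct_smul, ← Matrix.mulVec_mulVec,
    Matrix.dotProduct_mulVec, Matrix.vecMul_transpose, smul_eq_mul]

lemma IsSpanningTree.dotProduct_covMatrix (ht : IsSpanningTree t) (v : Fin (m + 1) × Fin d → ℝ) :
    v ⬝ᵥ (covMatrix x n).mulVec v =
      (diffMatrix d t).mulVec v ⬝ᵥ (gram x n t).mulVec ((diffMatrix d t).mulVec v) := by
  rw [gram_eq, Matrix.mulVec_mulVec, Matrix.mul_assoc,
    Matrix.nonsing_inv_mul _ ht.isUnit_det_diffMatrix, mul_one, ← Matrix.mulVec_mulVec,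
    Matrix.mulVec_transpose, dotProduct_comm ((diffMatrix d t).mulVec v), ← Matrix.dotProduct_mulVec,
    Matrix.mulVec_mulVec, Matrix.nonsing_inv_mul _ ht.isUnit_det_diffMatrix, Matrix.one_mulVec,
    dotProduct_comm]

lemma transDesign_transpose_mulVec (e : Fin (m + 1) → ℕ → ℝ) :
    (√(totalSize m n))⁻¹ • (transDesign x n t).transpose.mulVec (fun r => e r.1 r.2) =
      ((diffMatrix d t)⁻¹).transpose.mulVec (score x e n) := by
  rw [score, Matrix.mulVec_smul, Matrix.mulVec_mulVec, transDesign, Matrix.transpose_mul]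

lemma response_eq {y e : Fin (m + 1) → ℕ → ℝ} {β : Fin (m + 1) → Fin d → ℝ}
    (hy : ∀ k i, y k i = β k ⬝ᵥ x k i + e k i) (ht : IsSpanningTree t) :
    (fun r : Fin (m + 1) × Fin n => y r.1 r.2) =
      (transDesign x n t).mulVec (differences t β) + fun r => e r.1 r.2 := by
  rw [transDesign, differences, Matrix.mulVec_mulVec, Matrix.mul_assoc,
    Matrix.nonsing_inv_mul _ ht.isUnit_det_diffMatrix, Matrix.mul_one]
  ext r
  rw [Pi.add_apply, blockDesign_mulVec, hy]
  rfl

lemma norm_mulVec_le {ι κ : Type*} [Fintype ι] [Fintype κ] {M : Matrix κ ι ℝ} {L : ℝ} (hL : 0 ≤ L)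
    (hM : ∀ q q', |M q q'| ≤ L) (v : ι → ℝ) : ‖M.mulVec v‖ ≤ Fintype.card ι * L * ‖v‖ := by
  rw [pi_norm_le_iff_of_nonneg (by positivity)]
  intro q
  refine (norm_sum_le _ _).trans ?_
  calc ∑ q', ‖M q q' * v q'‖ ≤ ∑ _q' : ι, L * ‖v‖ := by
        refine Finset.sum_le_sum fun q' _ => ?_
        rw [norm_mul]
        exact mul_le_mul (hM q q') (norm_le_pi_norm v q') (norm_nonneg _) hL
    _ = _ := by simp [mul_assoc]

/-- The local least squares estimators solve the normal equations, hence their error is controlled by the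
score as soon as the Gram matrix is bounded below. -/
lemma sqrt_mul_norm_ols_sub_le {y e : Fin (m + 1) → ℕ → ℝ} {β : Fin (m + 1) → Fin d → ℝ}
    (hy : ∀ k i, y k i = β k ⬝ᵥ x k i + e k i) (hn : 0 < totalSize m n) {c : ℝ} (hc : 0 < c)
    (hS : ∀ v : Fin (m + 1) × Fin d → ℝ, c * ‖v‖ ^ 2 ≤ v ⬝ᵥ (covMatrix x n).mulVec v) :
    √(totalSize m n) * ‖fun q : Fin (m + 1) × Fin d => ols x y n q.1 q.2 - β q.1 q.2‖ ≤
      Fintype.card (Fin (m + 1) × Fin d) / c * ‖score x e n‖ := by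
  set N := totalSize m n with hN
  -- the Gram matrices of the nodes are the diagonal blocks of the one of the block design
  have hdet : ∀ k, IsUnit ((nodeDesign x n k).transpose * nodeDesign x n k).det := by
    intro k
    rw [isUnit_iff_ne_zero, Ne, ← Matrix.exists_mulVec_eq_zero_iff]
    rintro ⟨v, hv0, hv⟩
    let V : Fin (m + 1) × Fin d → ℝ := fun q => if q.1 = k then v q.2 else 0
    have h1 : (nodeDesign x n k).mulVec v = 0 := by
      rw [← dotProduct_self_eq_zero, ← Matrix.vecMul_transpose, ← Matrix.dotProduct_mulVec,
        Matrix.vecMul_transpose, Matrix.mulVec_mulVec, hv, dotProduct_zero]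
    have h2 : (blockDesign x n).mulVec V = 0 := by
      ext r
      rw [blockDesign_mulVec]
      by_cases hr : r.1 = k
      · have h3 := congrFun h1 r.2
        simp only [Matrix.mulVec, dotProduct, nodeDesign, Matrix.of_apply, Pi.zero_apply] at h3
        simp only [V, hr, if_true, Pi.zero_apply]
        rw [← h3]
        exact Finset.sum_congr rfl fun p _ => mul_comm _ _
      · simp [V, hr]
    have h3 := hS V
    rw [covMatrix, Matrix.smul_mulVec, ← Matrix.mulVec_mulVec, h2, Matrix.mulVec_zero, smul_zero,
      dotProduct_zero] at h3
    have h4 : ‖V‖ = 0 := by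
      have h5 : ‖V‖ ^ 2 ≤ 0 := by
        by_contra hcon
        push Not at hcon
        have := mul_pos hc hcon
        linarith
      exact pow_eq_zero_iff two_ne_zero |>.1 (le_antisymm h5 (sq_nonneg _))
    refine hv0 (funext fun p => ?_)
    have h5 := congrFun (norm_eq_zero.1 h4) (k, p)
    simpa [V] using h5
  set E : Fin (m + 1) × Fin d → ℝ := fun q => ols x y n q.1 q.2 - β q.1 q.2 with hE
  have hnormal : ∀ k, ((nodeDesign x n k).transpose * nodeDesign x n k).mulVec
      (fun p => E (k, p)) = (nodeDesign x n k).transpose.mulVec fun i => e k i := by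
    intro k
    have h1 : (fun p => E (k, p)) = ols x y n k - β k := rfl
    have h2 : (fun i : Fin n => y k i) = (nodeDesign x n k).mulVec (β k) + fun i : Fin n => e k i := by
      ext i
      rw [hy, dotProduct_comm]
      rfl
    rw [h1, Matrix.mulVec_sub, ols, Matrix.mulVec_mulVec, Matrix.mul_nonsing_inv _ (hdet k),
      Matrix.one_mulVec, h2, Matrix.mulVec_add, Matrix.mulVec_mulVec, add_sub_cancel_left]
  have hblock : ∀ (f : Fin (m + 1) × Fin n → ℝ) (q : Fin (m + 1) × Fin d),
      (blockDesign x n).transpose.mulVec f q =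
        (nodeDesign x n q.1).transpose.mulVec (fun i => f (q.1, i)) q.2 := by
    intro f q
    simp only [Matrix.mulVec, dotProduct, blockDesign, Matrix.transpose_apply, Matrix.of_apply,
      Fintype.sum_prod_type]
    rw [Finset.sum_eq_single q.1]
    · simp
    · intro b _ hb; simp [hb]
    · simp
  have hstack : ((blockDesign x n).transpose * blockDesign x n).mulVec E =
      (blockDesign x n).transpose.mulVec fun r => e r.1 r.2 := by
    ext q
    rw [← Matrix.mulVec_mulVec, hblock, hblock, ← hnormal, ← Matrix.mulVec_mulVec]
    congr 2
    ext i
    rw [blockDesign_mulVec]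
    simp only [Matrix.mulVec, dotProduct, nodeDesign, Matrix.of_apply]
    exact Finset.sum_congr rfl fun p _ => mul_comm _ _
  have hs : 0 < √N := Real.sqrt_pos.2 hn
  have hcov : (covMatrix x n).mulVec E = (√N)⁻¹ • score x e n := by
    rw [covMatrix, Matrix.smul_mulVec, hstack, score, smul_smul, ← mul_inv, Real.mul_self_sqrt hn.le,
      one_div]
  have h1 := hS E
  rw [hcov, dotProduct_smul, smul_eq_mul] at h1
  have h2 := dotProduct_le_card_mul E (score x e n)
  rcases (norm_nonneg E).eq_or_lt with h3 | h3
  · rw [← h3, mul_zero]; positivity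
  · rw [div_mul_eq_mul_div, le_div_iff₀ hc]
    refine le_of_mul_le_mul_right ?_ h3
    have h4 := h1.trans (mul_le_mul_of_nonneg_left h2 (inv_nonneg.2 hs.le))
    have h5 := mul_le_mul_of_nonneg_left h4 hs.le
    rw [mul_inv_cancel_left₀ hs.ne'] at h5
    linarith

end Design

/-! ### Rates of convergence of the score and of the local estimators -/

section Constants

lemma exists_forall_abs_le {α : Type*} [Finite α] (f : α → ℝ) : ∃ L > 0, ∀ z, |f z| ≤ L := by
  obtain ⟨L, hL⟩ := (Set.finite_range fun z => |f z|).bddAbove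
  exact ⟨max L 1, lt_max_of_lt_right one_pos,
    fun z => (hL (Set.mem_range_self z)).trans (le_max_left _ _)⟩

lemma exists_forall_le_abs {α : Type*} [Finite α] (f : α → ℝ) :
    ∃ a > 0, ∀ z, f z ≠ 0 → a ≤ |f z| := by
  obtain ⟨L, hL, h⟩ := exists_forall_abs_le fun z => (f z)⁻¹
  refine ⟨L⁻¹, inv_pos.2 hL, fun z hz => inv_le_of_inv_le₀ (abs_pos.2 hz) ?_⟩
  rw [← abs_inv]
  exact h z

lemma exists_diffMatrix_bound (m d : ℕ) : ∃ L > 0, ∀ (t : Fin m → Fin (m + 1) × Fin (m + 1))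
    (q q' : Fin (m + 1) × Fin d), |diffMatrix d t q q'| ≤ L ∧ |(diffMatrix d t)⁻¹ q q'| ≤ L := by
  obtain ⟨L, hL, h⟩ := exists_forall_abs_le
    fun z : (Fin m → Fin (m + 1) × Fin (m + 1)) × (Fin (m + 1) × Fin d) × (Fin (m + 1) × Fin d) =>
      diffMatrix d z.1 z.2.1 z.2.2
  obtain ⟨L', hL', h'⟩ := exists_forall_abs_le
    fun z : (Fin m → Fin (m + 1) × Fin (m + 1)) × (Fin (m + 1) × Fin d) × (Fin (m + 1) × Fin d) =>
      (diffMatrix d z.1)⁻¹ z.2.1 z.2.2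
  exact ⟨max L L', lt_max_of_lt_left hL, fun t q q' =>
    ⟨(h (t, q, q')).trans (le_max_left _ _), (h' (t, q, q')).trans (le_max_right _ _)⟩⟩

variable {ι : Type*} [Fintype ι]

/-- The supremum norm is used on coordinate vectors, so the bound is by compactness of its unit sphere. -/
lemma exists_quadratic_lower_bound {C : Matrix ι ι ℝ} (hC : C.PosDef) :
    ∃ c > 0, ∀ v : ι → ℝ, c * ‖v‖ ^ 2 ≤ v ⬝ᵥ C.mulVec v := by
  have hcont : Continuous fun v : ι → ℝ => v ⬝ᵥ C.mulVec v := by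
    simp only [dotProduct, Matrix.mulVec]
    fun_prop
  have hpos : ∀ v : ι → ℝ, v ≠ 0 → 0 < v ⬝ᵥ C.mulVec v := fun v hv => by
    simpa using hC.dotProduct_mulVec_pos hv
  rcases (Metric.sphere (0 : ι → ℝ) 1).eq_empty_or_nonempty with he | hne
  · refine ⟨1, one_pos, fun v => ?_⟩
    have hv : v = 0 := by
      by_contra hv
      have h1 : ‖v‖⁻¹ • v ∈ Metric.sphere (0 : ι → ℝ) 1 := by
        rw [mem_sphere_zero_iff_norm, norm_smul, norm_inv, norm_norm,
          inv_mul_cancel₀ (norm_ne_zero_iff.2 hv)]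
      rw [he] at h1
      exact h1
    simp [hv]
  · obtain ⟨v₀, hv₀, hmin⟩ := (isCompact_sphere (0 : ι → ℝ) 1).exists_isMinOn hne hcont.continuousOn
    have hv₀' : v₀ ≠ 0 := by
      rintro rfl
      simp at hv₀
    refine ⟨v₀ ⬝ᵥ C.mulVec v₀, hpos v₀ hv₀', fun v => ?_⟩
    rcases eq_or_ne v 0 with rfl | hv
    · simp
    have hnv : 0 < ‖v‖ := norm_pos_iff.2 hv
    have h1 : ‖v‖⁻¹ • v ∈ Metric.sphere (0 : ι → ℝ) 1 := by
      rw [mem_sphere_zero_iff_norm, norm_smul, norm_inv, norm_norm, inv_mul_cancel₀ hnv.ne']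
    have h2 : v₀ ⬝ᵥ C.mulVec v₀ ≤ (‖v‖⁻¹ • v) ⬝ᵥ C.mulVec (‖v‖⁻¹ • v) := hmin h1
    rw [Matrix.mulVec_smul, smul_dotProduct, dotProduct_smul, smul_eq_mul, smul_eq_mul] at h2
    have h3 := mul_le_mul_of_nonneg_right h2 (sq_nonneg ‖v‖)
    refine h3.trans_eq ?_
    field_simp

lemma quadratic_lower_bound_of_close {C M : Matrix ι ι ℝ} {c η : ℝ} (hη : 0 ≤ η)
    (hc : ∀ v : ι → ℝ, c * ‖v‖ ^ 2 ≤ v ⬝ᵥ C.mulVec v) (hM : ∀ q q', |M q q' - C q q'| ≤ η)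
    (v : ι → ℝ) :
    (c - Fintype.card ι * (Fintype.card ι * η)) * ‖v‖ ^ 2 ≤ v ⬝ᵥ M.mulVec v := by
  have h1 : v ⬝ᵥ M.mulVec v = v ⬝ᵥ C.mulVec v - v ⬝ᵥ (C - M).mulVec v := by
    rw [Matrix.sub_mulVec, dotProduct_sub]; ring
  have h2 := dotProduct_le_card_mul v ((C - M).mulVec v)
  have h3 : ‖(C - M).mulVec v‖ ≤ Fintype.card ι * η * ‖v‖ :=
    norm_mulVec_le hη (fun q q' => by rw [Matrix.sub_apply, abs_sub_comm]; exact hM q q') v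
  have h4 : (Fintype.card ι : ℝ) * (‖v‖ * ‖(C - M).mulVec v‖) ≤
      Fintype.card ι * (‖v‖ * (Fintype.card ι * η * ‖v‖)) := by gcongr
  have h5 := hc v
  rw [h1]
  linarith

end Constants

section Rates

variable {Ω : Type*} [MeasurableSpace Ω] {P : Measure Ω} {m d : ℕ}

/-- The linear model on the network with independent noise, together with a sequence of data-dependent
spanning trees whose normalized Gram matrices converge in probability. -/
structure IsNetworkModel (P : Measure Ω) (β : Fin (m + 1) → Fin d → ℝ)
    (x : Fin (m + 1) → ℕ → Ω → Fin d → ℝ) (ε y : Fin (m + 1) → ℕ → Ω → ℝ) (σ : ℝ)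
    (t : ℕ → Ω → Fin m → Fin (m + 1) × Fin (m + 1))
    (C : Matrix (Fin (m + 1) × Fin d) (Fin (m + 1) × Fin d) ℝ) : Prop where
  measurable : ∀ k i, Measurable (x k i)
  isNoise : IsNoise P (fun j : Fin (m + 1) × ℕ => ε j.1 j.2) σ
  response : ∀ k i ω, y k i ω = β k ⬝ᵥ x k i ω + ε k i ω
  indepFun : IndepFun (fun ω (j : Fin (m + 1) × ℕ) => x j.1 j.2 ω)
    (fun ω (j : Fin (m + 1) × ℕ) => ε j.1 j.2 ω) P
  isSpanningTree : ∀ n ω, IsSpanningTree (t n ω)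
  posDef : C.PosDef
  gram_tendsto : ∀ q q', Tendsto
    (fun p : ℕ × Ω => gram (fun k i => x k i p.2) p.1 (t p.1 p.2) q q') (whp P) (𝓝 (C q q'))

namespace IsNetworkModel

variable {β : Fin (m + 1) → Fin d → ℝ} {x : Fin (m + 1) → ℕ → Ω → Fin d → ℝ}
  {ε y : Fin (m + 1) → ℕ → Ω → ℝ} {σ : ℝ} {t : ℕ → Ω → Fin m → Fin (m + 1) × Fin (m + 1)}
  {C : Matrix (Fin (m + 1) × Fin d) (Fin (m + 1) × Fin d) ℝ}

lemma eventually_gram_close (h : IsNetworkModel P β x ε y σ t C) {η : ℝ} (hη : 0 < η) :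
    ∀ᶠ p : ℕ × Ω in whp P, ∀ q q',
      |gram (fun k i => x k i p.2) p.1 (t p.1 p.2) q q' - C q q'| ≤ η := by
  rw [eventually_all]
  intro q
  rw [eventually_all]
  intro q'
  filter_upwards [Metric.tendsto_nhds.1 (h.gram_tendsto q q') η hη] with p hp
  exact le_of_lt hp

lemma exists_gram_bounds (h : IsNetworkModel P β x ε y σ t C) :
    ∃ c > 0, ∃ K > 0, ∀ᶠ p : ℕ × Ω in whp P,
      (∀ v, c * ‖v‖ ^ 2 ≤ v ⬝ᵥ (gram (fun k i => x k i p.2) p.1 (t p.1 p.2)).mulVec v) ∧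
      ∀ q q', |gram (fun k i => x k i p.2) p.1 (t p.1 p.2) q q'| ≤ K := by
  obtain ⟨c, hc, hC⟩ := exists_quadratic_lower_bound h.posDef
  obtain ⟨L, hL, hCL⟩ := exists_forall_abs_le
    fun z : (Fin (m + 1) × Fin d) × (Fin (m + 1) × Fin d) => C z.1 z.2
  set k : ℝ := ((Fintype.card (Fin (m + 1) × Fin d) : ℕ) : ℝ) with hk
  have hk0 : 0 ≤ k := Nat.cast_nonneg _
  have hη : 0 < c / (2 * (k * k + 1)) := by positivity
  refine ⟨c / 2, by positivity, L + c / (2 * (k * k + 1)), by positivity, ?_⟩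
  filter_upwards [h.eventually_gram_close hη] with p hp
  refine ⟨fun v => ?_, fun q q' => ?_⟩
  · refine le_trans ?_ (quadratic_lower_bound_of_close hη.le hC hp v)
    refine mul_le_mul_of_nonneg_right ?_ (sq_nonneg _)
    rw [← hk]
    have h1 : k * (k * (c / (2 * (k * k + 1)))) = c / 2 * ((k * k) / (k * k + 1)) := by
      field_simp
    have h2 : (k * k) / (k * k + 1) ≤ 1 := (div_le_one (by positivity)).2 (by linarith)
    have h3 := mul_le_mul_of_nonneg_left h2 (by positivity : 0 ≤ c / 2)
    linarith
  · have h1 := hp q q'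
    have h2 := hCL (q, q')
    have h3 := abs_sub_abs_le_abs_sub (gram (fun k i => x k i p.2) p.1 (t p.1 p.2) q q') (C q q')
    linarith

lemma exists_covMatrix_bounds (h : IsNetworkModel P β x ε y σ t C) :
    ∃ c > 0, ∀ᶠ p : ℕ × Ω in whp P,
      ∀ v, c * ‖v‖ ^ 2 ≤ v ⬝ᵥ (covMatrix (fun k i => x k i p.2) p.1).mulVec v := by
  obtain ⟨c, hc, K, hK, hb⟩ := h.exists_gram_bounds
  obtain ⟨L, hL, hH⟩ := exists_diffMatrix_bound m d
  set k : ℝ := ((Fintype.card (Fin (m + 1) × Fin d) : ℕ) : ℝ) with hk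
  have hk0 : 0 ≤ k := Nat.cast_nonneg _
  refine ⟨c / (k * L + 1) ^ 2, by positivity, ?_⟩
  filter_upwards [hb] with p hp v
  have ht := h.isSpanningTree p.1 p.2
  rw [ht.dotProduct_covMatrix v]
  refine le_trans ?_ (hp.1 _)
  have h1 : ‖v‖ ≤ (k * L + 1) * ‖(diffMatrix d (t p.1 p.2)).mulVec v‖ := by
    have h2 := norm_mulVec_le hL.le (fun q q' => (hH (t p.1 p.2) q q').2)
      ((diffMatrix d (t p.1 p.2)).mulVec v)
    rw [Matrix.mulVec_mulVec, Matrix.nonsing_inv_mul _ ht.isUnit_det_diffMatrix,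
      Matrix.one_mulVec] at h2
    have := norm_nonneg ((diffMatrix d (t p.1 p.2)).mulVec v)
    linarith
  rw [div_mul_eq_mul_div, div_le_iff₀ (by positivity), mul_assoc]
  refine mul_le_mul_of_nonneg_left ?_ hc.le
  rw [mul_comm, ← mul_pow]
  exact pow_le_pow_left₀ (norm_nonneg _) h1 2

lemma eventually_dotProduct_covMatrix_le (h : IsNetworkModel P β x ε y σ t C)
    (θ : Fin (m + 1) × Fin d → ℝ) : ∃ K, ∀ᶠ p : ℕ × Ω in whp P,
      θ ⬝ᵥ (covMatrix (fun k i => x k i p.2) p.1).mulVec θ ≤ K := by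
  obtain ⟨c, hc, K, hK, hb⟩ := h.exists_gram_bounds
  obtain ⟨L, hL, hH⟩ := exists_diffMatrix_bound m d
  set k : ℝ := ((Fintype.card (Fin (m + 1) × Fin d) : ℕ) : ℝ) with hk
  have hk0 : 0 ≤ k := Nat.cast_nonneg _
  refine ⟨k * (k * L * ‖θ‖ * (k * K * (k * L * ‖θ‖))), ?_⟩
  filter_upwards [hb] with p hp
  rw [(h.isSpanningTree p.1 p.2).dotProduct_covMatrix θ]
  have h1 := norm_mulVec_le hL.le (fun q q' => (hH (t p.1 p.2) q q').1) θ
  have h2 := norm_mulVec_le hK.le hp.2 ((diffMatrix d (t p.1 p.2)).mulVec θ)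
  refine (dotProduct_le_card_mul _ _).trans ?_
  rw [← hk] at h1 h2 ⊢
  gcongr
  exact h2.trans (by gcongr)

lemma measurable_scoreWeight (θ : Fin (m + 1) × Fin d → ℝ) (n : ℕ) (j : Fin (m + 1) × ℕ) :
    Measurable (scoreWeight θ n j) := by
  refine (Finset.measurable_sum _ fun p _ => ?_).const_mul _
  have h1 : Measurable fun x : Fin (m + 1) × ℕ → Fin d → ℝ => x j p :=
    (measurable_pi_apply p).comp (measurable_pi_apply j)
  exact h1.const_mul _

lemma measurable_covariates (h : IsNetworkModel P β x ε y σ t C) :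
    Measurable fun ω (j : Fin (m + 1) × ℕ) => x j.1 j.2 ω :=
  measurable_pi_lambda _ fun j => h.measurable j.1 j.2

variable [IsProbabilityMeasure P]

lemma boundedInProb_score (h : IsNetworkModel P β x ε y σ t C) :
    BoundedInProb P fun p => ‖score (fun k i => x k i p.2) (fun k i => ε k i p.2) p.1‖ := by
  classical
  refine BoundedInProb.norm_pi fun q => ?_
  obtain ⟨K, hK⟩ := h.eventually_dotProduct_covMatrix_le (Pi.single q 1)
  have h1 := h.isNoise.boundedInProb_sum h.measurable_covariates h.indepFun
    (fun n => Finset.univ ×ˢ Finset.range n) (measurable_scoreWeight (Pi.single q 1)) K (by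
      filter_upwards [hK] with p hp
      rwa [dotProduct_covMatrix] at hp)
  convert! h1 using 2 with p
  rw [← single_one_dotProduct q (score _ _ _)]
  exact dotProduct_score _ _

lemma boundedInProb_ols (h : IsNetworkModel P β x ε y σ t C) :
    BoundedInProb P fun p => √(totalSize m p.1) * ‖fun q : Fin (m + 1) × Fin d =>
      ols (fun k i => x k i p.2) (fun k i => y k i p.2) p.1 q.1 q.2 - β q.1 q.2‖ := by
  obtain ⟨c, hc, hS⟩ := h.exists_covMatrix_bounds
  refine h.boundedInProb_score.of_le (c := Fintype.card (Fin (m + 1) × Fin d) / c) (b := 0)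
    (by positivity) ?_
  filter_upwards [hS, tendsto_fst_whp.eventually ((tendsto_totalSize m).eventually_gt_atTop 0)]
    with p hp hn
  rw [abs_norm, abs_of_nonneg (by positivity), add_zero]
  exact sqrt_mul_norm_ols_sub_le (fun k i => h.response k i p.2) hn hc hp

/-- The local least squares estimators are uniformly consistent. -/
lemma eventually_norm_ols_sub_le (h : IsNetworkModel P β x ε y σ t C) {η : ℝ} (hη : 0 < η) :
    ∀ᶠ p : ℕ × Ω in whp P, ‖fun q : Fin (m + 1) × Fin d =>
      ols (fun k i => x k i p.2) (fun k i => y k i p.2) p.1 q.1 q.2 - β q.1 q.2‖ ≤ η := by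
  filter_upwards [h.boundedInProb_ols.eventually_le
    ((tendsto_sqrt_totalSize m).atTop_mul_const hη),
    tendsto_fst_whp.eventually ((tendsto_sqrt_totalSize m).eventually_gt_atTop 0)] with p hp hn
  rw [abs_of_nonneg (by positivity)] at hp
  exact le_of_mul_le_mul_left hp hn

end IsNetworkModel

end Rates

/-! ### Selection consistency -/

section Selection

variable {Ω : Type*} [MeasurableSpace Ω] {P : Measure Ω} {m d : ℕ}

/-- Minimizers of the adaptive fused-lasso objective in the linear model on the network, with the
admissible growth of the tuning parameters. -/
structure IsFusedLassoFit (P : Measure Ω) (β : Fin (m + 1) → Fin d → ℝ)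
    (x : Fin (m + 1) → ℕ → Ω → Fin d → ℝ) (ε y : Fin (m + 1) → ℕ → Ω → ℝ) (σ : ℝ)
    (t : ℕ → Ω → Fin m → Fin (m + 1) × Fin (m + 1))
    (C : Matrix (Fin (m + 1) × Fin d) (Fin (m + 1) × Fin d) ℝ) (pen : Bool) (γ : ℝ) (lam : ℕ → ℝ)
    (Δhat : ℕ → Ω → Fin (m + 1) × Fin d → ℝ) : Prop extends
    IsNetworkModel P β x ε y σ t C where
  gamma_pos : 0 < γ
  lam_nonneg : ∀ n, 0 ≤ lam n
  lam_upper : Tendsto (fun n => lam n / √(totalSize m n)) atTop (𝓝 0)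
  lam_lower : Tendsto (fun n => lam n * totalSize m n ^ ((γ - 1) / 2)) atTop atTop
  isMinOn : ∀ n ω, IsMinOn (objective pen γ (lam n) (fun k i => x k i ω)
    (fun k i => y k i ω) n (t n ω)) Set.univ (Δhat n ω)

lemma objective_eq (pen : Bool) (γ lam : ℝ) (x : Fin (m + 1) → ℕ → Fin d → ℝ)
    (y : Fin (m + 1) → ℕ → ℝ) (n : ℕ) (t : Fin m → Fin (m + 1) × Fin (m + 1)) :
    objective pen γ lam x y n t = lassoObjective (transDesign x n t) (fun r => y r.1 r.2)
      (adaptiveWeight pen γ x y n t) lam := rfl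

lemma adaptiveWeight_of_isFree {pen : Bool} {γ : ℝ} {x : Fin (m + 1) → ℕ → Fin d → ℝ}
    {y : Fin (m + 1) → ℕ → ℝ} {n : ℕ} {t : Fin m → Fin (m + 1) × Fin (m + 1)}
    {q : Fin (m + 1) × Fin d} (hq : IsFree pen q) : adaptiveWeight pen γ x y n t q = 0 := by
  simp [adaptiveWeight, hq]

lemma adaptiveWeight_of_not_isFree {pen : Bool} {γ : ℝ} {x : Fin (m + 1) → ℕ → Fin d → ℝ}
    {y : Fin (m + 1) → ℕ → ℝ} {n : ℕ} {t : Fin m → Fin (m + 1) × Fin (m + 1)}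
    {q : Fin (m + 1) × Fin d} (hq : ¬ IsFree pen q) : adaptiveWeight pen γ x y n t q =
      (ENNReal.ofReal (|differences t (ols x y n) q| ^ γ))⁻¹ := by
  simp [adaptiveWeight, hq]

lemma abs_differences_sub_le {L : ℝ} (hL : 0 ≤ L) {t : Fin m → Fin (m + 1) × Fin (m + 1)}
    (hH : ∀ q q', |diffMatrix d t q q'| ≤ L) (b b' : Fin (m + 1) → Fin d → ℝ)
    (q : Fin (m + 1) × Fin d) :
    |differences t b q - differences t b' q| ≤ Fintype.card (Fin (m + 1) × Fin d) * L *
      ‖fun q : Fin (m + 1) × Fin d => b q.1 q.2 - b' q.1 q.2‖ := by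
  have h1 : differences t b - differences t b' =
      (diffMatrix d t).mulVec fun q => b q.1 q.2 - b' q.1 q.2 := by
    rw [differences, differences, ← Matrix.mulVec_sub]
    rfl
  rw [← Pi.sub_apply, h1]
  exact (norm_le_pi_norm _ q).trans (norm_mulVec_le hL hH _)

namespace IsFusedLassoFit

variable {β : Fin (m + 1) → Fin d → ℝ} {x : Fin (m + 1) → ℕ → Ω → Fin d → ℝ}
  {ε y : Fin (m + 1) → ℕ → Ω → ℝ} {σ : ℝ} {t : ℕ → Ω → Fin m → Fin (m + 1) × Fin (m + 1)}
  {C : Matrix (Fin (m + 1) × Fin d) (Fin (m + 1) × Fin d) ℝ} {pen : Bool} {γ : ℝ} {lam : ℕ → ℝ}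
  {Δhat : ℕ → Ω → Fin (m + 1) × Fin d → ℝ}

lemma eventually_lam_pos (h : IsFusedLassoFit P β x ε y σ t C pen γ lam Δhat) :
    ∀ᶠ n in atTop, 0 < lam n := by
  filter_upwards [h.lam_lower.eventually_gt_atTop 0] with n hn
  refine (h.lam_nonneg n).lt_of_ne fun h0 => ?_
  rw [← h0, zero_mul] at hn
  exact hn.false

lemma exists_true_differences_bound (β : Fin (m + 1) → Fin d → ℝ) :
    ∃ a > 0, ∀ (t : Fin m → Fin (m + 1) × Fin (m + 1)) q, differences t β q ≠ 0 →
      a ≤ |differences t β q| := by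
  obtain ⟨a, ha, h⟩ := exists_forall_le_abs
    fun z : (Fin m → Fin (m + 1) × Fin (m + 1)) × (Fin (m + 1) × Fin d) => differences z.1 β z.2
  exact ⟨a, ha, fun t q => h (t, q)⟩

/-- The normalized residual correlations in terms of the score and of the normalized error. -/
lemma residual_eq (h : IsFusedLassoFit P β x ε y σ t C pen γ lam Δhat) {n : ℕ}
    (hN : 0 < totalSize m n) (ω : Ω) :
    (√(totalSize m n))⁻¹ • (transDesign (fun k i => x k i ω) n (t n ω)).transpose.mulVec
        ((fun r => y r.1 r.2 ω) -
          (transDesign (fun k i => x k i ω) n (t n ω)).mulVec (Δhat n ω)) =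
      ((diffMatrix d (t n ω))⁻¹).transpose.mulVec
          (score (fun k i => x k i ω) (fun k i => ε k i ω) n) -
        (gram (fun k i => x k i ω) n (t n ω)).mulVec
          (√(totalSize m n) • (Δhat n ω - differences (t n ω) β)) := by
  have hs : 0 < √(totalSize m n) := Real.sqrt_pos.2 hN
  have hscal : 1 / totalSize m n * √(totalSize m n) = (√(totalSize m n))⁻¹ := by
    rw [eq_comm, inv_eq_iff_eq_inv, one_div, mul_inv, inv_inv, ← div_eq_mul_inv, Real.div_sqrt]
  rw [response_eq (x := fun k i => x k i ω) (n := n) (y := fun k i => y k i ω)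
    (fun k i => h.response k i ω) (h.isSpanningTree n ω), ← transDesign_transpose_mulVec, gram,
    Matrix.smul_mulVec, Matrix.mulVec_smul, smul_smul, hscal, ← smul_sub, ← Matrix.mulVec_mulVec,
    ← Matrix.mulVec_sub, Matrix.mulVec_sub (transDesign _ _ _)]
  congr 2
  abel

variable [IsProbabilityMeasure P]

/-- The penalty weights of the active coordinates are bounded. -/
lemma exists_weight_bound (h : IsFusedLassoFit P β x ε y σ t C pen γ lam Δhat) :
    ∃ W ≥ 0, ∀ᶠ p : ℕ × Ω in whp P, ∀ q,
      (differences (t p.1 p.2) β q ≠ 0 ∨ IsFree pen q) →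
        adaptiveWeight pen γ (fun k i => x k i p.2) (fun k i => y k i p.2) p.1 (t p.1 p.2) q ≠ ⊤ ∧
        (adaptiveWeight pen γ (fun k i => x k i p.2) (fun k i => y k i p.2) p.1
          (t p.1 p.2) q).toReal ≤ W := by
  obtain ⟨a, ha, hβ⟩ := exists_true_differences_bound β
  obtain ⟨L, hL, hH⟩ := exists_diffMatrix_bound m d
  set k : ℝ := ((Fintype.card (Fin (m + 1) × Fin d) : ℕ) : ℝ) with hk
  have hk0 : 0 ≤ k := Nat.cast_nonneg _
  have hη : 0 < a / 2 / (k * L + 1) := by positivity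
  refine ⟨((a / 2) ^ γ)⁻¹, by positivity, ?_⟩
  filter_upwards [h.eventually_norm_ols_sub_le hη] with p hp q hq
  by_cases hfree : IsFree pen q
  · rw [adaptiveWeight_of_isFree hfree]
    refine ⟨ENNReal.zero_ne_top, ?_⟩
    rw [ENNReal.toReal_zero]
    positivity
  have hq' := hβ _ q (hq.resolve_right hfree)
  have h1 := abs_differences_sub_le hL.le (fun q q' => (hH (t p.1 p.2) q q').1)
    (ols (fun k i => x k i p.2) (fun k i => y k i p.2) p.1) β q
  rw [← hk] at h1
  have h2 : k * L * (a / 2 / (k * L + 1)) ≤ a / 2 := by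
    rw [mul_div_assoc', div_le_iff₀ (by positivity)]
    nlinarith
  have h3 := mul_le_mul_of_nonneg_left hp (by positivity : 0 ≤ k * L)
  have h4 := abs_sub_abs_le_abs_sub (differences (t p.1 p.2) β q)
    (differences (t p.1 p.2) (ols (fun k i => x k i p.2) (fun k i => y k i p.2) p.1) q)
  rw [abs_sub_comm] at h4
  have h5 : a / 2 ≤
      |differences (t p.1 p.2) (ols (fun k i => x k i p.2) (fun k i => y k i p.2) p.1) q| := by
    linarith
  have h6 : (a / 2) ^ γ ≤
      |differences (t p.1 p.2) (ols (fun k i => x k i p.2) (fun k i => y k i p.2) p.1) q| ^ γ :=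
    Real.rpow_le_rpow (by positivity) h5 h.gamma_pos.le
  have h7 : 0 < (a / 2) ^ γ := by positivity
  rw [adaptiveWeight_of_not_isFree hfree]
  refine ⟨?_, ?_⟩
  · rw [ENNReal.inv_ne_top, Ne, ENNReal.ofReal_eq_zero, not_le]
    exact h7.trans_le h6
  · rw [ENNReal.toReal_inv, ENNReal.toReal_ofReal (by positivity)]
    exact inv_anti₀ h7 h6

lemma eventually_weight_ne_top (h : IsFusedLassoFit P β x ε y σ t C pen γ lam Δhat) :
    ∀ᶠ p : ℕ × Ω in whp P, ∀ q, Δhat p.1 p.2 q ≠ 0 →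
      adaptiveWeight pen γ (fun k i => x k i p.2) (fun k i => y k i p.2) p.1
        (t p.1 p.2) q ≠ ⊤ := by
  obtain ⟨W, hW, hw⟩ := h.exists_weight_bound
  filter_upwards [hw, tendsto_fst_whp.eventually h.eventually_lam_pos] with p hp hlam q hq
  have hmin := h.isMinOn p.1 p.2
  rw [objective_eq] at hmin
  exact weight_ne_top_of_isMinOn hlam hmin (fun q hq => (hp q (Or.inl hq)).1) hq

/-- The estimator converges at the rate `√N`. -/
lemma boundedInProb_error (h : IsFusedLassoFit P β x ε y σ t C pen γ lam Δhat) :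
    BoundedInProb P fun p =>
      √(totalSize m p.1) * ‖Δhat p.1 p.2 - differences (t p.1 p.2) β‖ := by
  obtain ⟨W, hW, hw⟩ := h.exists_weight_bound
  obtain ⟨c, hc, K, hK, hb⟩ := h.exists_gram_bounds
  obtain ⟨L, hL, hH⟩ := exists_diffMatrix_bound m d
  set k : ℝ := ((Fintype.card (Fin (m + 1) × Fin d) : ℕ) : ℝ) with hk
  have hk0 : 0 ≤ k := Nat.cast_nonneg _
  refine h.boundedInProb_score.of_le (c := 2 * k / c * (k * L)) (b := 2 * k / c * W)
    (by positivity) ?_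
  filter_upwards [hw, hb, tendsto_fst_whp.eventually h.eventually_lam_pos,
    tendsto_fst_whp.eventually ((tendsto_totalSize m).eventually_gt_atTop 0),
    tendsto_fst_whp.eventually (h.lam_upper.eventually (gt_mem_nhds one_pos))]
    with p hwp hbp hlam hN hup
  have hs : 0 < √(totalSize m p.1) := Real.sqrt_pos.2 hN
  have ht := h.isSpanningTree p.1 p.2
  have hmin := h.isMinOn p.1 p.2
  rw [objective_eq] at hmin
  have h1 := lasso_error_le (c := c * totalSize m p.1) hlam hmin
    (response_eq (n := p.1) (fun k i => h.response k i p.2) ht) hW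
    (fun q hq => hwp q (Or.inl hq)) (fun v => by
      have := hbp.1 v
      rw [dotProduct_gram, one_div, ← div_eq_inv_mul, le_div_iff₀ hN] at this
      linarith)
  rw [← hk] at h1
  have h2 : ‖(transDesign (fun k i => x k i p.2) p.1 (t p.1 p.2)).transpose.mulVec
      fun r => ε r.1 r.2 p.2‖ = √(totalSize m p.1) *
        ‖((diffMatrix d (t p.1 p.2))⁻¹).transpose.mulVec
          (score (fun k i => x k i p.2) (fun k i => ε k i p.2) p.1)‖ := by
    rw [← transDesign_transpose_mulVec, norm_smul, norm_inv, Real.norm_of_nonneg hs.le,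
      mul_inv_cancel_left₀ hs.ne']
  have h3 := norm_mulVec_le (M := ((diffMatrix d (t p.1 p.2))⁻¹).transpose) hL.le
    (fun q q' => (hH (t p.1 p.2) q' q).2)
    (score (fun k i => x k i p.2) (fun k i => ε k i p.2) p.1)
  rw [← hk] at h3
  rw [h2] at h1
  have h4 : lam p.1 ≤ √(totalSize m p.1) := by
    rw [div_lt_one hs] at hup
    exact hup.le
  rw [abs_norm, abs_of_nonneg (by positivity)]
  have h5 : lam p.1 * W ≤ √(totalSize m p.1) * W := mul_le_mul_of_nonneg_right h4 hW
  have h6 := mul_le_mul_of_nonneg_left h3 hs.le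
  have h7 : c * totalSize m p.1 * ‖Δhat p.1 p.2 - differences (t p.1 p.2) β‖ =
      √(totalSize m p.1) *
        (c * (√(totalSize m p.1) * ‖Δhat p.1 p.2 - differences (t p.1 p.2) β‖)) := by
    have := Real.mul_self_sqrt hN.le
    linear_combination (-(c * ‖Δhat p.1 p.2 - differences (t p.1 p.2) β‖)) * this
  rw [h7] at h1
  have h8 : √(totalSize m p.1) *
        (c * (√(totalSize m p.1) * ‖Δhat p.1 p.2 - differences (t p.1 p.2) β‖)) ≤
      √(totalSize m p.1) * (2 * k * (k * L *
        ‖score (fun k i => x k i p.2) (fun k i => ε k i p.2) p.1‖ + W)) := by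
    refine h1.trans ?_
    have : 2 * k * (√(totalSize m p.1) * ‖((diffMatrix d (t p.1 p.2))⁻¹).transpose.mulVec
          (score (fun k i => x k i p.2) (fun k i => ε k i p.2) p.1)‖ + lam p.1 * W) ≤
        2 * k * (√(totalSize m p.1) * (k * L *
          ‖score (fun k i => x k i p.2) (fun k i => ε k i p.2) p.1‖) + √(totalSize m p.1) * W) := by
      gcongr
    linarith
  have h9 := le_of_mul_le_mul_left h8 hs
  have h10 : 2 * k / c * (k * L) * ‖score (fun k i => x k i p.2) (fun k i => ε k i p.2) p.1‖ +
      2 * k / c * W = (2 * k * (k * L *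
        ‖score (fun k i => x k i p.2) (fun k i => ε k i p.2) p.1‖ + W)) / c := by
    ring
  rw [h10, le_div_iff₀ hc]
  linarith

lemma boundedInProb_residual (h : IsFusedLassoFit P β x ε y σ t C pen γ lam Δhat) :
    BoundedInProb P fun p => ‖(√(totalSize m p.1))⁻¹ •
      (transDesign (fun k i => x k i p.2) p.1 (t p.1 p.2)).transpose.mulVec
        ((fun r => y r.1 r.2 p.2) -
          (transDesign (fun k i => x k i p.2) p.1 (t p.1 p.2)).mulVec (Δhat p.1 p.2))‖ := by
  obtain ⟨c, hc, K, hK, hb⟩ := h.exists_gram_bounds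
  obtain ⟨L, hL, hH⟩ := exists_diffMatrix_bound m d
  set k : ℝ := ((Fintype.card (Fin (m + 1) × Fin d) : ℕ) : ℝ) with hk
  have hk0 : 0 ≤ k := Nat.cast_nonneg _
  refine (h.boundedInProb_score.add h.boundedInProb_error).of_le (c := k * L + k * K) (b := 0)
    (by positivity) ?_
  filter_upwards [hb, tendsto_fst_whp.eventually ((tendsto_totalSize m).eventually_gt_atTop 0)]
    with p hbp hN
  rw [h.residual_eq hN, abs_norm, add_zero]
  have h1 := norm_mulVec_le (M := ((diffMatrix d (t p.1 p.2))⁻¹).transpose) hL.le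
    (fun q q' => (hH (t p.1 p.2) q' q).2)
    (score (fun k i => x k i p.2) (fun k i => ε k i p.2) p.1)
  have h2 := norm_mulVec_le hK.le hbp.2
    (√(totalSize m p.1) • (Δhat p.1 p.2 - differences (t p.1 p.2) β))
  rw [norm_smul, Real.norm_of_nonneg (Real.sqrt_nonneg _)] at h2
  refine (norm_sub_le _ _).trans ((add_le_add h1 h2).trans ?_)
  rw [← hk]
  have h3 : 0 ≤ ‖score (fun k i => x k i p.2) (fun k i => ε k i p.2) p.1‖ := norm_nonneg _
  have h4 : 0 ≤ √(totalSize m p.1) * ‖Δhat p.1 p.2 - differences (t p.1 p.2) β‖ := by positivity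
  rw [abs_of_nonneg (by positivity)]
  nlinarith [mul_nonneg (mul_nonneg hk0 hL.le) h4, mul_nonneg (mul_nonneg hk0 hK.le) h3]

/-- No active coordinate is missed, since the estimator is consistent. -/
lemma eventually_active (h : IsFusedLassoFit P β x ε y σ t C pen γ lam Δhat) :
    ∀ᶠ p : ℕ × Ω in whp P, ∀ q, differences (t p.1 p.2) β q ≠ 0 → Δhat p.1 p.2 q ≠ 0 := by
  obtain ⟨a, ha, hβ⟩ := exists_true_differences_bound β
  filter_upwards [h.boundedInProb_error.eventually_le
    ((tendsto_sqrt_totalSize m).atTop_mul_const (half_pos ha)),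
    tendsto_fst_whp.eventually ((tendsto_sqrt_totalSize m).eventually_gt_atTop 0)]
    with p hp hN q hq h0
  rw [abs_of_nonneg (by positivity)] at hp
  have h1 := le_of_mul_le_mul_left hp hN
  have h2 := norm_le_pi_norm (Δhat p.1 p.2 - differences (t p.1 p.2) β) q
  rw [Pi.sub_apply, h0, zero_sub, norm_neg, Real.norm_eq_abs] at h2
  linarith [hβ _ q hq]

/-- Penalized coordinates whose true value vanishes are set to zero: otherwise the stationarity of the
minimizer would bound the penalty, which by the lower growth condition on `lam` is of larger order than
the residual correlations. -/
lemma eventually_inactive (h : IsFusedLassoFit P β x ε y σ t C pen γ lam Δhat) :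
    ∀ᶠ p : ℕ × Ω in whp P, ∀ q, differences (t p.1 p.2) β q = 0 → ¬ IsFree pen q →
      Δhat p.1 p.2 q = 0 := by
  obtain ⟨L, hL, hH⟩ := exists_diffMatrix_bound m d
  set k : ℝ := ((Fintype.card (Fin (m + 1) × Fin d) : ℕ) : ℝ) with hk
  have hk0 : 0 ≤ k := Nat.cast_nonneg _
  have hγ := h.gamma_pos
  -- a sequence tending to infinity so slowly that `M ^ (1 + γ)` is dominated by the penalty
  let M : ℕ → ℝ := fun n => (lam n * totalSize m n ^ ((γ - 1) / 2) / 2) ^ (1 / (1 + γ))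
  have hM : Tendsto M atTop atTop :=
    (tendsto_rpow_atTop (by positivity)).comp (h.lam_lower.atTop_div_const two_pos)
  filter_upwards [h.boundedInProb_residual.eventually_le hM,
    h.boundedInProb_ols.eventually_le (hM.atTop_div_const (by positivity : 0 < k * L + 1)),
    tendsto_fst_whp.eventually h.eventually_lam_pos, h.eventually_weight_ne_top,
    tendsto_fst_whp.eventually ((tendsto_totalSize m).eventually_gt_atTop 0),
    tendsto_fst_whp.eventually (h.lam_lower.eventually_gt_atTop 0)]
    with p hres hols hlam hw hN hA q hq hfree
  by_contra hne
  have hs : 0 < √(totalSize m p.1) := Real.sqrt_pos.2 hN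
  have hmin := h.isMinOn p.1 p.2
  rw [objective_eq] at hmin
  have h1 := weight_le_abs_residual hlam hmin hw hne
  have hwq := hw q hne
  rw [adaptiveWeight_of_not_isFree hfree] at h1 hwq
  set δ := |differences (t p.1 p.2)
    (ols (fun k i => x k i p.2) (fun k i => y k i p.2) p.1) q| with hδ
  rw [ENNReal.inv_ne_top, Ne, ENNReal.ofReal_eq_zero, not_le] at hwq
  rw [ENNReal.toReal_inv, ENNReal.toReal_ofReal hwq.le, ← div_eq_mul_inv, div_le_iff₀ hwq] at h1
  rw [abs_norm, norm_smul, norm_inv, Real.norm_of_nonneg hs.le, ← div_eq_inv_mul, div_le_iff₀ hs]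
    at hres
  have h2 := (norm_le_pi_norm _ q).trans hres
  rw [Real.norm_eq_abs] at h2
  have hM0 : 0 ≤ M p.1 := by positivity
  have h3 := abs_differences_sub_le hL.le (fun q q' => (hH (t p.1 p.2) q q').1)
    (ols (fun k i => x k i p.2) (fun k i => y k i p.2) p.1) β q
  rw [hq, sub_zero, ← hk, ← hδ] at h3
  rw [abs_of_nonneg (by positivity), le_div_iff₀ (by positivity)] at hols
  have h4 : δ ≤ M p.1 / √(totalSize m p.1) := by
    rw [le_div_iff₀ hs]
    refine (mul_le_mul_of_nonneg_right h3 hs.le).trans (le_trans ?_ hols)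
    have : 0 ≤ √(totalSize m p.1) * ‖fun q : Fin (m + 1) × Fin d =>
      ols (fun k i => x k i p.2) (fun k i => y k i p.2) p.1 q.1 q.2 - β q.1 q.2‖ := by positivity
    linarith
  have h5 : δ ^ γ ≤ M p.1 ^ γ / √(totalSize m p.1) ^ γ := by
    rw [← Real.div_rpow hM0 hs.le]
    exact Real.rpow_le_rpow (abs_nonneg _) h4 hγ.le
  have h6 : lam p.1 ≤ M p.1 * √(totalSize m p.1) * (M p.1 ^ γ / √(totalSize m p.1) ^ γ) :=
    h1.trans (mul_le_mul h2 h5 hwq.le (by positivity))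
  have h7 : totalSize m p.1 ^ ((γ - 1) / 2) = √(totalSize m p.1) ^ γ / √(totalSize m p.1) := by
    rw [← Real.rpow_sub_one hs.ne', Real.sqrt_eq_rpow, ← Real.rpow_mul hN.le]
    congr 1; ring
  have h8 : M p.1 * M p.1 ^ γ = lam p.1 * totalSize m p.1 ^ ((γ - 1) / 2) / 2 := by
    have h9 : 0 < M p.1 := by
      have : 0 < lam p.1 * totalSize m p.1 ^ ((γ - 1) / 2) / 2 := by positivity
      exact Real.rpow_pos_of_pos this _
    rw [← Real.rpow_one_add' h9.le (by positivity), ← Real.rpow_mul (by positivity),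
      one_div_mul_cancel (by positivity), Real.rpow_one]
  have hsγ : 0 < √(totalSize m p.1) ^ γ := Real.rpow_pos_of_pos hs _
  have h10 : lam p.1 * totalSize m p.1 ^ ((γ - 1) / 2) ≤ M p.1 * M p.1 ^ γ := by
    rw [h7, mul_div_assoc', div_le_iff₀ hs]
    refine (mul_le_mul_of_nonneg_right h6 hsγ.le).trans_eq ?_
    field_simp
  rw [h8] at h10
  linarith

lemma tendsto_selection (h : IsFusedLassoFit P β x ε y σ t C pen γ lam Δhat) :
    Tendsto (fun n => P {ω |
      support (Δhat n ω) ∪ freeZeros pen (differences (t n ω) β) =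
        support (differences (t n ω) β) ∪ freeZeros pen (differences (t n ω) β)}) atTop (𝓝 1) := by
  refine tendsto_measure_one_of_eventually_whp (Q := fun p : ℕ × Ω =>
    support (Δhat p.1 p.2) ∪ freeZeros pen (differences (t p.1 p.2) β) =
      support (differences (t p.1 p.2) β) ∪ freeZeros pen (differences (t p.1 p.2) β)) ?_
  filter_upwards [h.eventually_active, h.eventually_inactive] with p h1 h2
  ext q
  have h3 := h1 q
  have h4 := h2 q
  simp only [support, freeZeros, Finset.mem_union, Finset.mem_filter, Finset.mem_univ, true_and]
  tauto

end IsFusedLassoFit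

end Selection

/-! ### Asymptotic normality -/

section Normality

variable {Ω : Type*} [MeasurableSpace Ω] {P : Measure Ω} {m d : ℕ}

section Extension

variable {ι : Type*} [Fintype ι] [DecidableEq ι] {A : Finset ι}

/-- Extension by zero of a vector indexed by `A`. -/
def extendZero (α : A → ℝ) (q : ι) : ℝ := if h : q ∈ A then α ⟨q, h⟩ else 0

lemma sum_mul_extendZero (f : ι → ℝ) (α : A → ℝ) :
    ∑ q, f q * extendZero α q = ∑ q : A, f q * α q := by
  rw [← Finset.sum_subset (Finset.subset_univ A), ← Finset.sum_coe_sort A]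
  · refine Finset.sum_congr rfl fun q _ => ?_
    rw [extendZero, dif_pos q.2]
  · intro q _ hq
    rw [extendZero, dif_neg hq, mul_zero]

lemma extendZero_dotProduct_mulVec (M : Matrix ι ι ℝ) (α : A → ℝ) :
    extendZero α ⬝ᵥ M.mulVec (extendZero α) =
      α ⬝ᵥ (M.submatrix (Subtype.val : A → ι) (Subtype.val : A → ι)).mulVec α := by
  rw [dotProduct_comm, dotProduct, sum_mul_extendZero, dotProduct_comm]
  refine Finset.sum_congr rfl fun q _ => ?_
  rw [Matrix.mulVec, dotProduct, sum_mul_extendZero]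
  rfl

end Extension

namespace IsNetworkModel

variable {β : Fin (m + 1) → Fin d → ℝ} {x : Fin (m + 1) → ℕ → Ω → Fin d → ℝ}
  {ε y : Fin (m + 1) → ℕ → Ω → ℝ} {σ : ℝ} {t : ℕ → Ω → Fin m → Fin (m + 1) × Fin (m + 1)}
  {C : Matrix (Fin (m + 1) × Fin d) (Fin (m + 1) × Fin d) ℝ}

lemma measurable_dotProduct_score (h : IsNetworkModel P β x ε y σ t C)
    (θ : Fin (m + 1) × Fin d → ℝ) (n : ℕ) :
    Measurable fun ω => θ ⬝ᵥ score (fun k i => x k i ω) (fun k i => ε k i ω) n := by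
  simp only [dotProduct_score]
  exact Finset.measurable_sum _ fun j _ =>
    ((measurable_scoreWeight θ n j).comp h.measurable_covariates).mul (h.isNoise.measurable j)

/-- The quadratic form of the Gram matrix `XᵀX / N` at a vector whose transform by the tree does not
depend on the tree converges in probability, although the matrix itself need not converge. -/
lemma tendsto_dotProduct_covMatrix (h : IsNetworkModel P β x ε y σ t C)
    {θ v : Fin (m + 1) × Fin d → ℝ}
    (hθ : ∀ᶠ p : ℕ × Ω in whp P, (diffMatrix d (t p.1 p.2)).mulVec θ = v) :
    Tendsto (fun p : ℕ × Ω => θ ⬝ᵥ (covMatrix (fun k i => x k i p.2) p.1).mulVec θ) (whp P)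
      (𝓝 (v ⬝ᵥ C.mulVec v)) := by
  have h1 : Tendsto (fun p : ℕ × Ω => v ⬝ᵥ
      (gram (fun k i => x k i p.2) p.1 (t p.1 p.2)).mulVec v) (whp P) (𝓝 (v ⬝ᵥ C.mulVec v)) := by
    simp only [dotProduct, Matrix.mulVec]
    exact tendsto_finsetSum _ fun q _ => (tendsto_finsetSum _ fun q' _ =>
      (h.gram_tendsto q q').mul_const _).const_mul _
  refine h1.congr' ?_
  filter_upwards [hθ] with p hp
  rw [(h.isSpanningTree p.1 p.2).dotProduct_covMatrix θ, hp]

lemma eventually_scoreWeight_le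
    {θ : Fin (m + 1) × Fin d → ℝ} {τ : ℝ}
    (hθ : Tendsto (fun p : ℕ × Ω => θ ⬝ᵥ (covMatrix (fun k i => x k i p.2) p.1).mulVec θ) (whp P)
      (𝓝 τ)) {η : ℝ} (hη : 0 < η) :
    ∀ᶠ p : ℕ × Ω in whp P, ∀ j ∈ (Finset.univ : Finset (Fin (m + 1))) ×ˢ Finset.range p.1,
      |scoreWeight θ p.1 j (fun j => x j.1 j.2 p.2)| ≤ η := by
  let v : Fin (m + 1) → ℕ → Ω → ℝ := fun k i ω => ∑ p, θ (k, p) * x k i ω p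
  let S : ℕ → Ω → ℝ := fun n ω => ∑ i ∈ Finset.range n, ∑ k, v k i ω ^ 2
  have hm : (0 : ℝ) < (m : ℝ) + 1 := by positivity
  have hS : Tendsto (fun p : ℕ × Ω => S p.1 p.2 / p.1) (whp P) (𝓝 (((m : ℝ) + 1) * τ)) := by
    refine (hθ.const_mul ((m : ℝ) + 1)).congr fun p => ?_
    rw [_root_.FusedLasso.dotProduct_covMatrix, Finset.sum_product_right, Finset.mul_sum,
      Finset.sum_div]
    refine Finset.sum_congr rfl fun i _ => ?_
    rw [Finset.mul_sum, Finset.sum_div]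
    refine Finset.sum_congr rfl fun k _ => ?_
    rw [scoreWeight, mul_pow, inv_pow, Real.sq_sqrt (totalSize_nonneg m p.1), totalSize_eq, mul_inv,
      ← mul_assoc, mul_inv_cancel_left₀ hm.ne', div_eq_inv_mul]
  have hmono : ∀ ω, Monotone fun n => S n ω := fun ω => monotone_nat_of_le_succ fun n => by
    simp only [S, Finset.sum_range_succ]
    exact le_add_of_nonneg_right (Finset.sum_nonneg fun _ _ => sq_nonneg _)
  have hinc := eventually_increment_le (fun ω => by simp [S]) hmono hS
    (by positivity : 0 < ((m : ℝ) + 1) * η ^ 2)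
  filter_upwards [hinc] with p hp j hj
  have hj2 : j.2 < p.1 := Finset.mem_range.1 (Finset.mem_product.1 hj).2
  have hn : (0 : ℝ) < p.1 := by exact_mod_cast (Nat.zero_le _).trans_lt hj2
  have h1 := hp j.2 hj2
  simp only [S, Finset.sum_range_succ, add_sub_cancel_left] at h1
  have h2 : v j.1 j.2 p.2 ^ 2 ≤ ∑ k, v k j.2 p.2 ^ 2 :=
    Finset.single_le_sum (f := fun k => v k j.2 p.2 ^ 2) (fun _ _ => sq_nonneg _)
      (Finset.mem_univ j.1)
  refine abs_le_of_sq_le_sq ?_ hη.le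
  have h3 : scoreWeight θ p.1 j (fun j => x j.1 j.2 p.2) ^ 2 =
      v j.1 j.2 p.2 ^ 2 / (((m : ℝ) + 1) * p.1) := by
    rw [scoreWeight, mul_pow, inv_pow, Real.sq_sqrt (totalSize_nonneg m p.1), totalSize_eq,
      div_eq_inv_mul]
  rw [h3, div_le_iff₀ (by positivity)]
  linarith

variable [IsProbabilityMeasure P]

/-- The central limit theorem for the score. Only the columns of the inverse difference matrix with
index in `A` are assumed to be asymptotically equal to those of a fixed matrix `B`. -/
lemma tendstoInDistribution_score (h : IsNetworkModel P β x ε y σ t C)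
    {A : Finset (Fin (m + 1) × Fin d)} {B : Matrix (Fin (m + 1) × Fin d) A ℝ}
    (hB : ∀ᶠ p : ℕ × Ω in whp P, ∀ q (q' : A), (diffMatrix d (t p.1 p.2))⁻¹ q q' = B q q') :
    TendstoInDistribution
      (fun n ω => WithLp.toLp 2
        ((C.submatrix (Subtype.val : A → _) (Subtype.val : A → _))⁻¹.mulVec
          (B.transpose.mulVec (score (fun k i => x k i ω) (fun k i => ε k i ω) n))))
      atTop (id : EuclideanSpace ℝ A → EuclideanSpace ℝ A) (fun _ => P)
      (multivariateGaussian 0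
        (σ ^ 2 • (C.submatrix (Subtype.val : A → _) (Subtype.val : A → _))⁻¹)) := by
  set CA := C.submatrix (Subtype.val : A → _) (Subtype.val : A → _) with hCA
  have hCApos : CA.PosDef := h.posDef.submatrix Subtype.val_injective
  have hdet : IsUnit CA.det := (Matrix.isUnit_iff_isUnit_det CA).1 hCApos.isUnit
  have hsymm : (CA⁻¹).transpose = CA⁻¹ := by simpa using hCApos.inv.isHermitian.eq
  have hpsd : (σ ^ 2 • CA⁻¹).PosSemidef := hCApos.inv.posSemidef.smul (sq_nonneg σ)
  let θ : EuclideanSpace ℝ A → Fin (m + 1) × Fin d → ℝ := fun a => B.mulVec (CA⁻¹.mulVec a)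
  have hinner : ∀ (a : EuclideanSpace ℝ A) (s : Fin (m + 1) × Fin d → ℝ),
      inner ℝ (WithLp.toLp 2 (CA⁻¹.mulVec (B.transpose.mulVec s))) a = θ a ⬝ᵥ s := by
    intro a s
    have h1 : inner ℝ (WithLp.toLp 2 (CA⁻¹.mulVec (B.transpose.mulVec s))) a =
        (CA⁻¹.mulVec (B.transpose.mulVec s)) ⬝ᵥ (a : A → ℝ) := by
      rw [EuclideanSpace.inner_eq_star_dotProduct, dotProduct_comm]
      simp
    rw [h1, dotProduct_comm, Matrix.dotProduct_mulVec, ← Matrix.mulVec_transpose, hsymm,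
      Matrix.dotProduct_mulVec, Matrix.vecMul_transpose]
  have hmeas : ∀ n, Measurable fun ω => WithLp.toLp 2 (CA⁻¹.mulVec
      (B.transpose.mulVec (score (fun k i => x k i ω) (fun k i => ε k i ω) n))) := by
    intro n
    refine (WithLp.measurable_toLp 2 _).comp (measurable_pi_lambda _ fun q => ?_)
    refine Finset.measurable_sum _ fun q' _ => Measurable.const_mul ?_ _
    exact h.measurable_dotProduct_score (fun q => B q q') n
  refine ⟨fun n => (hmeas n).aemeasurable, aemeasurable_id, ?_⟩
  refine ProbabilityMeasure.tendsto_of_tendsto_charFun fun a => ?_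
  simp only [ProbabilityMeasure.coe_mk, Measure.map_id]
  rw [charFun_multivariateGaussian hpsd]
  have hθ : ∀ᶠ p : ℕ × Ω in whp P,
      (diffMatrix d (t p.1 p.2)).mulVec (θ a) = extendZero (CA⁻¹.mulVec a) := by
    filter_upwards [hB] with p hp
    have h1 : θ a = (diffMatrix d (t p.1 p.2))⁻¹.mulVec (extendZero (CA⁻¹.mulVec a)) := by
      ext q
      rw [Matrix.mulVec, dotProduct, sum_mul_extendZero]
      exact Finset.sum_congr rfl fun q' _ => by rw [hp q q']
    rw [h1, Matrix.mulVec_mulVec,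
      Matrix.mul_nonsing_inv _ (h.isSpanningTree p.1 p.2).isUnit_det_diffMatrix, Matrix.one_mulVec]
  have hlim := h.tendsto_dotProduct_covMatrix hθ
  have hτ : extendZero (CA⁻¹.mulVec a) ⬝ᵥ C.mulVec (extendZero (CA⁻¹.mulVec a)) =
      (a : A → ℝ) ⬝ᵥ CA⁻¹.mulVec a := by
    rw [extendZero_dotProduct_mulVec, ← hCA, Matrix.mulVec_mulVec, Matrix.mul_nonsing_inv _ hdet,
      Matrix.one_mulVec, dotProduct_comm]
  rw [hτ] at hlim
  have hsum : Tendsto (fun p : ℕ × Ω =>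
      ∑ j ∈ (Finset.univ : Finset (Fin (m + 1))) ×ˢ Finset.range p.1,
        scoreWeight (θ a) p.1 j (fun j => x j.1 j.2 p.2) ^ 2) (whp P)
      (𝓝 ((a : A → ℝ) ⬝ᵥ CA⁻¹.mulVec a)) := by
    refine hlim.congr fun p => ?_
    rw [_root_.FusedLasso.dotProduct_covMatrix]
  have hclt := h.isNoise.tendsto_integral_exp_sum h.measurable_covariates h.indepFun (0, 0)
    (fun n => Finset.univ ×ˢ Finset.range n) (measurable_scoreWeight (θ a)) hsum
    fun η hη => eventually_scoreWeight_le hlim hη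
  convert! hclt using 2 with n
  · rw [charFun_apply, integral_map (hmeas n).aemeasurable (by fun_prop)]
    congr 1 with ω
    rw [hinner, dotProduct_score]
  · congr 1
    rw [Matrix.smul_mulVec, dotProduct_smul]
    simp

/-- The minimum spanning tree eventually joins adjacent nodes of a cluster inside the cluster, since the
local estimators separate the clusters. -/
lemma eventually_isClusterTree (h : IsNetworkModel P β x ε y σ t C)
    {G : SimpleGraph (Fin (m + 1))} (hG : G.Connected)
    (hmst : ∀ n ω, IsMinSpanningTree
      (similarity G (fun k i => x k i ω) (fun k i => y k i ω) n) (t n ω)) :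
    ∀ᶠ p : ℕ × Ω in whp P, IsClusterTree G β (t p.1 p.2) := by
  obtain ⟨a, ha, hsep⟩ := exists_forall_le_abs fun z : Fin (m + 1) × Fin (m + 1) =>
    ‖WithLp.toLp 2 (β z.1) - WithLp.toLp 2 (β z.2)‖
  have hols : ∀ i, Tendsto (fun p : ℕ × Ω => WithLp.toLp 2
      (ols (fun k i => x k i p.2) (fun k i => y k i p.2) p.1 i)) (whp P)
      (𝓝 (WithLp.toLp 2 (β i))) := by
    intro i
    refine ((PiLp.continuous_toLp 2 _).tendsto (β i)).comp (tendsto_pi_nhds.2 fun p' => ?_)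
    rw [Metric.tendsto_nhds]
    intro η hη
    filter_upwards [h.eventually_norm_ols_sub_le (half_pos hη)] with p hp
    rw [Real.dist_eq]
    have := norm_le_pi_norm (fun q : Fin (m + 1) × Fin d =>
      ols (fun k i => x k i p.2) (fun k i => y k i p.2) p.1 q.1 q.2 - β q.1 q.2) (i, p')
    rw [Real.norm_eq_abs] at this
    linarith
  have hdist := fun i j => ((hols i).sub (hols j)).norm
  have hall : ∀ᶠ p : ℕ × Ω in whp P, ∀ i j,
      (β i = β j → ‖WithLp.toLp 2 (ols (fun k i => x k i p.2) (fun k i => y k i p.2) p.1 i) -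
        WithLp.toLp 2 (ols (fun k i => x k i p.2) (fun k i => y k i p.2) p.1 j)‖ < a / 2) ∧
      (β i ≠ β j → a / 2 ≤ ‖WithLp.toLp 2 (ols (fun k i => x k i p.2) (fun k i => y k i p.2) p.1 i)
        - WithLp.toLp 2 (ols (fun k i => x k i p.2) (fun k i => y k i p.2) p.1 j)‖) := by
    rw [eventually_all]
    intro i
    rw [eventually_all]
    intro j
    by_cases hij : β i = β j
    · have h1 := hdist i j
      rw [hij, sub_self, norm_zero] at h1
      filter_upwards [h1.eventually (gt_mem_nhds (half_pos ha))] with p hp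
      exact ⟨fun _ => hp, fun hne => absurd hij hne⟩
    · have h2 : ‖WithLp.toLp 2 (β i) - WithLp.toLp 2 (β j)‖ ≠ 0 := by
        rw [norm_ne_zero_iff, sub_ne_zero]
        exact fun h3 => hij (WithLp.toLp_injective 2 h3)
      have h3 := hsep (i, j) h2
      simp only [abs_norm] at h3
      filter_upwards [(hdist i j).eventually (lt_mem_nhds ((half_lt_self ha).trans_le h3))]
        with p hp
      exact ⟨fun he => absurd he hij, fun _ => hp.le⟩
  filter_upwards [hall] with p hp
  exact (hmst p.1 p.2).isClusterTree hG (fun i j => (hp i j).1) (fun i j => (hp i j).2)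

end IsNetworkModel

namespace IsFusedLassoFit

variable {β : Fin (m + 1) → Fin d → ℝ} {x : Fin (m + 1) → ℕ → Ω → Fin d → ℝ}
  {ε y : Fin (m + 1) → ℕ → Ω → ℝ} {σ : ℝ} {t : ℕ → Ω → Fin m → Fin (m + 1) × Fin (m + 1)}
  {C : Matrix (Fin (m + 1) × Fin d) (Fin (m + 1) × Fin d) ℝ} {pen : Bool} {γ : ℝ} {lam : ℕ → ℝ}
  {Δhat : ℕ → Ω → Fin (m + 1) × Fin d → ℝ} [IsProbabilityMeasure P]

/-- On the active coordinates the residual correlations are negligible, because the penalty is. -/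
lemma tendsto_active_residual (h : IsFusedLassoFit P β x ε y σ t C pen γ lam Δhat)
    {q : Fin (m + 1) × Fin d}
    (hq : ∀ᶠ p : ℕ × Ω in whp P, differences (t p.1 p.2) β q ≠ 0 ∨ IsFree pen q) :
    Tendsto (fun p : ℕ × Ω => ((√(totalSize m p.1))⁻¹ •
      (transDesign (fun k i => x k i p.2) p.1 (t p.1 p.2)).transpose.mulVec
        ((fun r => y r.1 r.2 p.2) -
          (transDesign (fun k i => x k i p.2) p.1 (t p.1 p.2)).mulVec (Δhat p.1 p.2))) q)
      (whp P) (𝓝 0) := by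
  obtain ⟨W, hW, hw⟩ := h.exists_weight_bound
  have hlim : Tendsto (fun p : ℕ × Ω => lam p.1 / √(totalSize m p.1) * W) (whp P) (𝓝 0) := by
    have := (h.lam_upper.mul_const W).comp (tendsto_fst_whp (P := P))
    rwa [zero_mul] at this
  refine squeeze_zero_norm' ?_ hlim
  filter_upwards [hq, hw, h.eventually_weight_ne_top,
    tendsto_fst_whp.eventually h.eventually_lam_pos] with p hqp hwp hfin hlam
  have hmin := h.isMinOn p.1 p.2
  rw [objective_eq] at hmin
  have h1 := abs_residual_le hlam hmin hfin (hwp q hqp).1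
  have h2 := mul_le_mul_of_nonneg_left (hwp q hqp).2 hlam.le
  rw [Pi.smul_apply, smul_eq_mul, norm_mul, norm_inv, Real.norm_of_nonneg (Real.sqrt_nonneg _),
    Real.norm_eq_abs, div_mul_eq_mul_div, div_eq_inv_mul]
  exact mul_le_mul_of_nonneg_left (h1.trans h2) (inv_nonneg.2 (Real.sqrt_nonneg _))

/-- The normalized error on the active coordinates differs negligibly from the least squares error of the
submodel. -/
lemma tendsto_error_sub (h : IsFusedLassoFit P β x ε y σ t C pen γ lam Δhat)
    {Δ₀ : Fin (m + 1) × Fin d → ℝ}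
    (hΔ₀ : ∀ᶠ p : ℕ × Ω in whp P, differences (t p.1 p.2) β = Δ₀)
    {A : Finset (Fin (m + 1) × Fin d)} (hA : ∀ q, q ∈ A ↔ Δ₀ q ≠ 0 ∨ IsFree pen q)
    {B : Matrix (Fin (m + 1) × Fin d) A ℝ}
    (hB : ∀ᶠ p : ℕ × Ω in whp P, ∀ q (q' : A), (diffMatrix d (t p.1 p.2))⁻¹ q q' = B q q') :
    Tendsto (fun p : ℕ × Ω => (fun q : A => √(totalSize m p.1) * (Δhat p.1 p.2 q - Δ₀ q)) -
      (C.submatrix (Subtype.val : A → _) (Subtype.val : A → _))⁻¹.mulVec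
        (B.transpose.mulVec (score (fun k i => x k i p.2) (fun k i => ε k i p.2) p.1)))
      (whp P) (𝓝 0) := by
  set CA := C.submatrix (Subtype.val : A → _) (Subtype.val : A → _) with hCA
  have hCApos : CA.PosDef := h.posDef.submatrix Subtype.val_injective
  have hdet : IsUnit CA.det := (Matrix.isUnit_iff_isUnit_det CA).1 hCApos.isUnit
  let u : ℕ × Ω → A → ℝ := fun p q => √(totalSize m p.1) * (Δhat p.1 p.2 q - Δ₀ q)
  have hu : ∀ q, BoundedInProb P fun p => u p q := by
    intro q
    refine h.boundedInProb_error.of_le (c := 1) (b := 0) zero_le_one ?_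
    filter_upwards [hΔ₀] with p hp
    rw [hp, one_mul, add_zero, abs_mul, abs_mul, abs_norm]
    exact mul_le_mul_of_nonneg_left (norm_le_pi_norm (Δhat p.1 p.2 - Δ₀) q) (abs_nonneg _)
  have hD : Tendsto (fun p : ℕ × Ω => CA.mulVec (u p) -
      B.transpose.mulVec (score (fun k i => x k i p.2) (fun k i => ε k i p.2) p.1))
      (whp P) (𝓝 0) := by
    rw [tendsto_pi_nhds]
    intro q
    have hres := h.tendsto_active_residual (q := (q : Fin (m + 1) × Fin d)) (by
      filter_upwards [hΔ₀] with p hp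
      rw [hp]
      exact (hA q).1 q.2)
    have hquad : Tendsto (fun p : ℕ × Ω => ∑ q' : A,
        (C q q' - gram (fun k i => x k i p.2) p.1 (t p.1 p.2) q q') * u p q') (whp P) (𝓝 0) := by
      rw [← Finset.sum_const_zero (s := (Finset.univ : Finset A))]
      refine tendsto_finsetSum _ fun q' _ => (hu q').tendsto_mul_zero ?_
      simpa using (tendsto_const_nhds (x := C q q')).sub (h.gram_tendsto q q')
    have hsub := hquad.sub hres
    rw [sub_zero] at hsub
    refine hsub.congr' ?_
    filter_upwards [hΔ₀, hB, h.eventually_inactive,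
      tendsto_fst_whp.eventually ((tendsto_totalSize m).eventually_gt_atTop 0)]
      with p hp hBp hin hN
    rw [h.residual_eq hN, hp]
    have h1 : (((diffMatrix d (t p.1 p.2))⁻¹).transpose.mulVec
        (score (fun k i => x k i p.2) (fun k i => ε k i p.2) p.1)) q =
        B.transpose.mulVec (score (fun k i => x k i p.2) (fun k i => ε k i p.2) p.1) q := by
      refine Finset.sum_congr rfl fun q' _ => ?_
      exact congrArg (· * _) (hBp q' q)
    have h2 : √(totalSize m p.1) • (Δhat p.1 p.2 - Δ₀) = extendZero (u p) := by
      ext q'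
      by_cases hq' : q' ∈ A
      · simp [extendZero, hq', u]
      · have h3 : Δ₀ q' = 0 ∧ ¬ IsFree pen q' := by
          rw [hA] at hq'
          push Not at hq'
          exact hq'
        have h4 := hin q' (by rw [hp]; exact h3.1) h3.2
        simp [extendZero, hq', h4, h3.1]
    have h5 : (gram (fun k i => x k i p.2) p.1 (t p.1 p.2)).mulVec (extendZero (u p)) q =
        ∑ q' : A, gram (fun k i => x k i p.2) p.1 (t p.1 p.2) q q' * u p q' := by
      rw [Matrix.mulVec, dotProduct, sum_mul_extendZero]
    have h6 : CA.mulVec (u p) q = ∑ q' : A, C q q' * u p q' := rfl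
    rw [Pi.sub_apply, Pi.sub_apply, h1, h2, h5, h6]
    simp only [sub_mul, Finset.sum_sub_distrib]
    ring
  have hcont : Continuous fun v : A → ℝ => CA⁻¹.mulVec v :=
    continuous_const.matrix_mulVec continuous_id
  have hfin := (hcont.tendsto 0).comp hD
  rw [Matrix.mulVec_zero] at hfin
  refine hfin.congr fun p => ?_
  simp only [Function.comp]
  rw [Matrix.mulVec_sub, Matrix.mulVec_mulVec, Matrix.nonsing_inv_mul _ hdet, Matrix.one_mulVec]

lemma tendstoInDistribution (h : IsFusedLassoFit P β x ε y σ t C pen γ lam Δhat)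
    {G : SimpleGraph (Fin (m + 1))} (hG : G.Connected)
    (hmst : ∀ n ω, IsMinSpanningTree
      (similarity G (fun k i => x k i ω) (fun k i => y k i ω) n) (t n ω))
    (ht_meas : ∀ n, Measurable (t n)) (hΔ_meas : ∀ n, AEMeasurable (Δhat n) P)
    {t₀ : Fin m → Fin (m + 1) × Fin (m + 1)} (ht₀ : IsSpanningTree t₀)
    (hsame : Tendsto (fun n => P {ω | SameInterCluster β (t n ω) t₀}) atTop (𝓝 1))
    {A : Finset (Fin (m + 1) × Fin d)}
    (hA : A = support (differences t₀ β) ∪ freeZeros pen (differences t₀ β)) :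
    TendstoInDistribution
      (fun n ω => WithLp.toLp 2 fun q : A =>
        √(totalSize m n) * (Δhat n ω q - differences t₀ β q))
      atTop (id : EuclideanSpace ℝ A → EuclideanSpace ℝ A) (fun _ => P)
      (multivariateGaussian 0
        (σ ^ 2 • (C.submatrix (Subtype.val : A → _) (Subtype.val : A → _))⁻¹)) := by
  have hmem : ∀ q, q ∈ A ↔ differences t₀ β q ≠ 0 ∨ IsFree pen q := by
    intro q
    rw [hA]
    simp only [support, freeZeros, Finset.mem_union, Finset.mem_filter, Finset.mem_univ, true_and]
    tauto
  have hsame' : ∀ᶠ p : ℕ × Ω in whp P, SameInterCluster β (t p.1 p.2) t₀ :=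
    eventually_whp_of_tendsto_measure_one
      (fun n => ht_meas n (MeasurableSet.of_discrete (s := {t | SameInterCluster β t t₀}))) hsame
  have hclus := h.eventually_isClusterTree hG hmst
  -- any cluster tree with the inter-cluster edges of `t₀` provides the limiting columns
  obtain ⟨p₁, hp₁, hp₁'⟩ := (hsame'.and hclus).exists
  set t₁ := t p₁.1 p₁.2 with ht₁
  have hΔ₀ : ∀ᶠ p : ℕ × Ω in whp P, differences (t p.1 p.2) β = differences t₀ β := by
    filter_upwards [hsame'] with p hp
    exact hp.differences_eq (h.isSpanningTree p.1 p.2).lt ht₀.lt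
  have hB : ∀ᶠ p : ℕ × Ω in whp P, ∀ q (q' : A), (diffMatrix d (t p.1 p.2))⁻¹ q q' =
      (Matrix.of fun q (q' : A) => (diffMatrix d t₁)⁻¹ q q') q q' := by
    filter_upwards [hsame', hclus] with p hp hcl q q'
    rw [Matrix.of_apply, inv_diffMatrix_apply, inv_diffMatrix_apply]
    congr 1
    refine inv_augIncidence_col_eq hcl hp₁' (hp.symm_trans hp₁) ?_ _
    intro l hl heq
    rcases (hmem q').1 q'.2 with h1 | h1
    · rw [← hp.differences_eq (h.isSpanningTree p.1 p.2).lt ht₀.lt, differences_apply, ← hl,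
        augIncidence_mulVec_castSucc (h.isSpanningTree p.1 p.2).lt, heq, sub_self] at h1
      exact h1 rfl
    · rw [h1.2] at hl
      exact absurd hl (Fin.castSucc_lt_last l).ne
  refine tendstoInDistribution_of_tendstoInMeasure_sub _ _ (h.tendstoInDistribution_score hB) ?_ ?_
  · refine tendstoInMeasure_iff_tendsto_whp.2 ?_
    exact ((PiLp.continuous_toLp 2 _).tendsto _).comp (h.tendsto_error_sub hΔ₀ hmem hB)
  · intro n
    refine (WithLp.measurable_toLp 2 _).comp_aemeasurable ?_
    refine aemeasurable_pi_lambda _ fun q => ?_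
    exact (((measurable_pi_apply _).comp_aemeasurable (hΔ_meas n)).sub_const _).const_mul _

end IsFusedLassoFit

end Normality

end FusedLasso

theorem theorem1 {Ω : Type*} [MeasurableSpace Ω] (P : Measure Ω) [IsProbabilityMeasure P]
    {m d : ℕ}
    -- the network and the true coefficient vectors of the nodes; a cluster is a maximal set of nodes
    -- with the same coefficient vector
    (G : SimpleGraph (Fin (m + 1))) (β : Fin (m + 1) → Fin d → ℝ)
    (hconn : G.Connected)
    (hnet : ∀ i, 2 < {j | β j = β i}.ncard → ∃ j, j ≠ i ∧ β j = β i ∧ G.Adj i j)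
    -- the linear model with i.i.d. errors that are independent of the covariates
    (x : Fin (m + 1) → ℕ → Ω → Fin d → ℝ) (ε y : Fin (m + 1) → ℕ → Ω → ℝ) (σ : ℝ)
    (hx : ∀ k i, Measurable (x k i)) (hε : ∀ k i, Measurable (ε k i))
    (hy : ∀ k i ω, y k i ω = β k ⬝ᵥ x k i ω + ε k i ω)
    (hindep : iIndepFun (fun q : Fin (m + 1) × ℕ => ε q.1 q.2) P)
    (hident : ∀ k i k' i', IdentDistrib (ε k i) (ε k' i') P P)
    (hL2 : ∀ k i, MemLp (ε k i) 2 P)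
    (hmean : ∀ k i, ∫ ω, ε k i ω ∂P = 0)
    (hvar : ∀ k i, variance (ε k i) P = σ ^ 2)
    (hxε : IndepFun (fun ω (q : Fin (m + 1) × ℕ) => x q.1 q.2 ω)
      (fun ω (q : Fin (m + 1) × ℕ) => ε q.1 q.2 ω) P)
    -- the minimum spanning tree for the similarity weights, with any (measurable) choice among ties
    -- and any enumeration of its edges
    (t : ℕ → Ω → Fin m → Fin (m + 1) × Fin (m + 1))
    (ht_meas : ∀ n, Measurable (t n))
    (ht : ∀ n ω, FusedLasso.IsMinSpanningTree
      (FusedLasso.similarity G (fun k i => x k i ω) (fun k i => y k i ω) n) (t n ω))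
    -- convergence in probability of the normalized Gram matrix
    (C : Matrix (Fin (m + 1) × Fin d) (Fin (m + 1) × Fin d) ℝ) (hC : C.PosDef)
    (hgram : ∀ q q', TendstoInMeasure P
      (fun n ω => FusedLasso.gram (fun k i => x k i ω) n (t n ω) q q') atTop (fun _ => C q q'))
    -- the tuning parameters
    (γ : ℝ) (hγ : 0 < γ) (lam : ℕ → ℝ) (hlam : ∀ n, 0 ≤ lam n)
    (hlam_upper : Tendsto (fun n => lam n / √(FusedLasso.totalSize m n)) atTop (𝓝 0))
    (hlam_lower : Tendsto (fun n => lam n * FusedLasso.totalSize m n ^ ((γ - 1) / 2)) atTop atTop)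
    -- the estimator
    (pen : Bool) (Δhat : ℕ → Ω → Fin (m + 1) × Fin d → ℝ)
    (hΔ_meas : ∀ n, AEMeasurable (Δhat n) P)
    (hΔ : ∀ n ω, IsMinOn (FusedLasso.objective pen γ (lam n) (fun k i => x k i ω)
      (fun k i => y k i ω) n (t n ω)) Set.univ (Δhat n ω)) :
    -- selection consistency
    Tendsto (fun n => P {ω |
        FusedLasso.support (Δhat n ω) ∪
            FusedLasso.freeZeros pen (FusedLasso.differences (t n ω) β) =
          FusedLasso.support (FusedLasso.differences (t n ω) β) ∪
            FusedLasso.freeZeros pen (FusedLasso.differences (t n ω) β)}) atTop (𝓝 1) ∧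
    -- asymptotic normality, as soon as the inter-cluster edges of the tree are asymptotically
    -- nonrandom, so that the active true differences and their index set are fixed quantities
    ∀ t₀ : Fin m → Fin (m + 1) × Fin (m + 1), FusedLasso.IsSpanningTree t₀ →
      Tendsto (fun n => P {ω | FusedLasso.SameInterCluster β (t n ω) t₀}) atTop (𝓝 1) →
      ∀ A : Finset (Fin (m + 1) × Fin d),
        A = FusedLasso.support (FusedLasso.differences t₀ β) ∪
          FusedLasso.freeZeros pen (FusedLasso.differences t₀ β) →
        TendstoInDistribution
          (fun n ω => WithLp.toLp 2 fun q : A =>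
            √(FusedLasso.totalSize m n) *
              (Δhat n ω q - FusedLasso.differences t₀ β q))
          atTop (id : EuclideanSpace ℝ A → EuclideanSpace ℝ A) (fun _ => P)
          (multivariateGaussian 0
            (σ ^ 2 • (C.submatrix (Subtype.val : A → _) (Subtype.val : A → _))⁻¹)) := by
  have hfit : FusedLasso.IsFusedLassoFit P β x ε y σ t C pen γ lam Δhat :=
    { measurable := hx
      isNoise :=
        { measurable := fun j => hε j.1 j.2
          indep := hindep
          ident := fun j j' => hident j.1 j.2 j'.1 j'.2
          memLp := fun j => hL2 j.1 j.2
          mean := fun j => hmean j.1 j.2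
          var := fun j => hvar j.1 j.2 }
      response := hy
      indepFun := hxε
      isSpanningTree := fun n ω => (ht n ω).1
      posDef := hC
      gram_tendsto := fun q q' => (FusedLasso.tendstoInMeasure_iff_tendsto_whp (P := P)
        (f := fun n ω => FusedLasso.gram (fun k i => x k i ω) n (t n ω) q q')
        (c := C q q')).1 (hgram q q')
      gamma_pos := hγ
      lam_nonneg := hlam
      lam_upper := hlam_upper
      lam_lower := hlam_lower
      isMinOn := hΔ }
  exact ⟨hfit.tendsto_selection, fun t₀ ht₀ hsame A hA =>
    hfit.tendstoInDistribution hconn ht ht_meas hΔ_meas ht₀ hsame hA⟩
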